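/- **Setting.** Let $V$ be a finite set with $m$ elements, let $\Pi$ be the uniform distribution on $V$, and for a real $V\times V$ matrix $S$ put $\|S\|_{L_2(\Pi^2)}^2=m^{-2}\sum_{u,v\in V}S(u,v)^2$. Let $\|S\|_1={\rm tr}|S|$ be the nuclear norm. Let $\{e_v\}_{v\in V}$ be the canonical basis of $\mathbb R^V$, and let $P_L$ be the orthogonal projector onto a subspace $L\subset\mathbb R^V$. Let $W=\sum_{k=1}^m\lambda_k(\phi_k\otimes\phi_k)$ be a symmetric nonnegative definite $V\times V$ matrix (for instance $W=d\Delta^p$ with $\Delta$ the Laplacian of a graph on $V$ and $d,p>0$), where $0\le\lambda_1\le\dots\le\lambda_m$ and $\phi_1,\dots,\phi_m$ are orthonormal. Suppose that $W\neq 0$, let $k_0$ be the smallest $k$ with $\lambda_k>0$, and put $\lambda_{m+1}^{-1}:=0$. Assume that for some $\zeta\ge 1$ and $c>0$ * $\lambda_m\le m^{\zeta}$ and $\lambda_{k_0}\ge m^{-\zeta}$; * $k\mapsto k/\lambda_k$ is nonincreasing on $\{k_0,\dots,m\}$; * $\lambda_{k+1}\le c\lambda_k$ for $k_0\le k\le m-1$;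 * $\sum_{k=s}^m\lambda_k^{-1}\le c\,s/\lambda_s$ for $k_0\le s\le m$. Let $S_*$ be a symmetric kernel on $V\times V$ of rank $r\ge1$, and let $L={\rm supp}(S_*)$ be the linear span of its eigenvectors with nonzero eigenvalues. Let $(X_j,X_j',Y_j)$, $j=1,\dots,n$, be i.i.d. triples in $V\times V\times\{-1,1\}$, where $X_j,X_j'$ are independent with distribution $\Pi$ and $\mathbb E(Y_j\mid X_j=u,X_j'=v)=S_*(u,v)$. Let $\mathbb D$ be a closed convex set of symmetric kernels with $S_*\in\mathbb D$. For $t>0$ let $$t_{n,m}=t+\log\bigl(2m(\log_2(4n^{\zeta}m^{(3/2)\zeta})+2)\bigr),\qquad \varepsilon=4\sqrt{\frac{t+\log(2m)}{nm}},$$ assume $m\,t_{n,m}\le n$, and for $\bar\varepsilon>0$ let $$\hat S=\mathop{\rm argmin}_{S\in\mathbb D}\Bigl[\|S\|_{L_2(\Pi^2)}^2-\frac2n\sum_{j=1}^nY_jS(X_j,X_j')+\varepsilon\|S\|_1+\bar\varepsilon\|W^{1/2}S\|_{L_2(\Pi^2)}^2\Bigr].$$ **Corollary 1.** There are constants $C,C_1>0$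 depending only on $c$ such that the following holds in this setting. Suppose that, for some $\nu\ge1$, the weak low coherence condition $$\sum_{j=1}^k\|P_L\phi_j\|^2\le\frac{\nu rk}{m},\qquad k=1,\dots,m,$$ holds. Then for all $s\in\{k_0+1,\dots,m+1\}$ and all $\bar\varepsilon\in(\lambda_s^{-1},\lambda_{s-1}^{-1}]$, with probability at least $1-e^{-t}$, $$\|\hat S-S_*\|_{L_2(\Pi^2)}^2\le C\,\frac{\nu r s\,t_{n,m}}{n}+\bar\varepsilon\,\|W^{1/2}S_*\|_{L_2(\Pi^2)}^2+C_1\max_{v\in V}\|P_Le_v\|^2\Bigl(\frac{m\,t_{n,m}}{n}\Bigr)^2 .$$ -/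

import Mathlib

open MeasureTheory ProbabilityTheory
open scoped MatrixOrder

noncomputable section

namespace SimilarityKernel

variable {V : Type*} [Fintype V] [DecidableEq V]

/-- The squared norm `‖S‖²` in `L₂(Π²)`, where `Π` is the uniform distribution on `V`:
the average of `S(u,v)²` over all pairs `(u,v)`. -/
def l2Sq (S : Matrix V V ℝ) : ℝ :=
  (∑ u, ∑ v, S u v ^ 2) / (Fintype.card V : ℝ) ^ 2

/-- The nuclear norm `tr |S|`, with `|S| = √(Sᵀ S)`. -/
def nuclearNorm (S : Matrix V V ℝ) : ℝ :=
  (CFC.abs S).trace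

/-- The support of a symmetric kernel: the linear span of the eigenvectors that belong to
nonzero eigenvalues. -/
def supp (S : Matrix V V ℝ) : Submodule ℝ (EuclideanSpace ℝ V) :=
  Submodule.span ℝ {ψ | ∃ σ : ℝ, σ ≠ 0 ∧ Matrix.toEuclideanLin S ψ = σ • ψ}

/-- `‖P_L x‖²`, the squared Euclidean norm of the orthogonal projection of `x` onto `L`. -/
def projSq (L : Submodule ℝ (EuclideanSpace ℝ V)) (x : EuclideanSpace ℝ V) : ℝ :=
  ‖L.starProjection x‖ ^ 2

/-- `max_{v ∈ V} ‖P_L e_v‖²` for the canonical basis `(e_v)`. -/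
def maxCoherence (L : Submodule ℝ (EuclideanSpace ℝ V)) : ℝ :=
  ⨆ v : V, projSq L (EuclideanSpace.single v 1)

/-- A spectral representation `W = ∑_{k=1}^m λ_k (φ_k ⊗ φ_k)`, `m = card V`, with
`0 ≤ λ_1 ≤ ⋯ ≤ λ_m` and `φ_1, …, φ_m` orthonormal. Only the indices `1, …, m` matter. -/
structure IsSpectralRepr (W : Matrix V V ℝ) (lam : ℕ → ℝ) (phi : ℕ → EuclideanSpace ℝ V) :
    Prop where
  nonneg : ∀ k ∈ Finset.Icc 1 (Fintype.card V), 0 ≤ lam k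
  mono : ∀ k ∈ Finset.Icc 1 (Fintype.card V), ∀ l ∈ Finset.Icc 1 (Fintype.card V),
    k ≤ l → lam k ≤ lam l
  orthonormal : Orthonormal ℝ (fun k : Finset.Icc 1 (Fintype.card V) => phi k)
  eq_sum : W = ∑ k ∈ Finset.Icc 1 (Fintype.card V),
    lam k • Matrix.vecMulVec (phi k).ofLp (phi k).ofLp

/-- The conditions on the spectrum `λ_1 ≤ ⋯ ≤ λ_m`; `k₀` is the smallest index of a positive
eigenvalue. -/
structure SpectrumCondition (m : ℕ) (lam : ℕ → ℝ) (k₀ : ℕ) (ζ c : ℝ) : Prop where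
  isLeast : IsLeast {k | k ∈ Finset.Icc 1 m ∧ 0 < lam k} k₀
  le_top : lam m ≤ (m : ℝ) ^ ζ
  ge_bot : (m : ℝ) ^ (-ζ) ≤ lam k₀
  ratio_antitone : ∀ k, k₀ ≤ k → k + 1 ≤ m → ((k + 1 : ℕ) : ℝ) / lam (k + 1) ≤ (k : ℝ) / lam k
  growth : ∀ k, k₀ ≤ k → k + 1 ≤ m → lam (k + 1) ≤ c * lam k
  tail : ∀ s, k₀ ≤ s → s ≤ m → ∑ k ∈ Finset.Icc s m, 1 / lam k ≤ c * ((s : ℝ) / lam s)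

/-- `λ_s⁻¹`, with the convention `λ_{m+1}⁻¹ = 0`. -/
def invEig (m : ℕ) (lam : ℕ → ℝ) (s : ℕ) : ℝ :=
  if s ≤ m then (lam s)⁻¹ else 0

/-- `t_{n,m} = t + log (2 m (log₂ (4 n^ζ m^{3ζ/2}) + 2))`. -/
def tnm (t ζ : ℝ) (n m : ℕ) : ℝ :=
  t + Real.log (2 * m * (Real.logb 2 (4 * (n : ℝ) ^ ζ * (m : ℝ) ^ (3 / 2 * ζ)) + 2))

/-- The regularization parameter `ε = 4 √((t + log (2m)) / (n m))`. -/
def regEps (t : ℝ) (n m : ℕ) : ℝ :=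
  4 * Real.sqrt ((t + Real.log (2 * m)) / (n * m))

/-- The penalized empirical risk
`‖S‖²_{L₂(Π²)} - (2/n) ∑ⱼ yⱼ S(xⱼ, x'ⱼ) + ε ‖S‖₁ + ε̄ ‖W^{1/2} S‖²_{L₂(Π²)}`. -/
def risk {n : ℕ} (W : Matrix V V ℝ) (ε εbar : ℝ) (x x' : Fin n → V) (y : Fin n → ℝ)
    (S : Matrix V V ℝ) : ℝ :=
  l2Sq S - 2 / (n : ℝ) * ∑ j, y j * S (x j) (x' j) + ε * nuclearNorm S
    + εbar * l2Sq (CFC.sqrt W * S)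

/-- `(X_j, X'_j, Y_j)`, `j < n`, are independent; in each triple `X_j` and `X'_j` are independent
and uniform on `V`, `Y_j ∈ {-1, 1}`, and `E(Y_j | X_j = u, X'_j = v) = S⋆(u, v)`. These properties
determine the law of a triple, so the triples are identically distributed. -/
structure IsSample [MeasurableSpace V] {Ω : Type*} [MeasurableSpace Ω] (μ : Measure Ω) {n : ℕ}
    (Sstar : Matrix V V ℝ) (X X' : Fin n → Ω → V) (Y : Fin n → Ω → ℝ) : Prop where
  law_fst : ∀ j, HasLaw (X j) (uniformOn Set.univ) μ
  law_snd : ∀ j, HasLaw (X' j) (uniformOn Set.univ) μ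
  indep_pair : ∀ j, IndepFun (X j) (X' j) μ
  measurable_fst : ∀ j, Measurable (X j)
  measurable_snd : ∀ j, Measurable (X' j)
  measurable_label : ∀ j, Measurable (Y j)
  label : ∀ j ω, Y j ω = -1 ∨ Y j ω = 1
  regression : ∀ j u v, ∫ ω, Y j ω ∂(μ[|X j ⁻¹' {u} ∩ X' j ⁻¹' {v}]) = Sstar u v
  indep : iIndepFun (fun j ω => (X j ω, X' j ω, Y j ω)) μ

end SimilarityKernel

end

/-! Convexity of the penalized risk turns minimality of `Ŝ` into a basic inequality in which the
noise `Ξ`, the centred empirical matrix of the sample, enters through `tr (Ξᵀ (Ŝ - S⋆))`. Let `P` be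
the projection onto `supp S⋆` and `Δ = Ŝ - S⋆`. The corner `(1 - P) Δ (1 - P)` is absorbed by the
subgradient of the nuclear norm, because `ε` dominates `(2/n) ‖Ξ‖` by the matrix Bernstein
inequality, which rests on the Golden–Thompson inequality. The remaining linear functionals of `Δ`
are given by `ε sgn S⋆`, `Ξᵀ P` and `(1 - P) Ξ P`; pairing them with `Δ` by Cauchy–Schwarz in the
metric of `1 + ε̄ W` is paid for by the left-hand side up to the squared Frobenius norms of `R sgn
S⋆`, `R Ξᵀ P` and `R (1 - P) Ξ P`, where `RᵀR = (1 + ε̄ W)⁻¹`. Low coherence and summation by parts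
bound the first by `(ν r / m) tr (1 + ε̄ W)⁻¹`. The other two concentrate, by the vector case of the
matrix Bernstein inequality, with a variance proportional to `r tr (1 + ε̄ W)⁻¹`. The tail condition
on the spectrum gives `tr (1 + ε̄ W)⁻¹ ≤ (1 + c) s`. -/

noncomputable section

namespace SimilarityKernel

section LieTrotter

open Filter Topology

variable {𝔸 : Type*} [NormedRing 𝔸] [NormOneClass 𝔸]

lemma norm_pow_sub_pow_le {x y : 𝔸} {M : ℝ} (hM : 1 ≤ M) (hx : ‖x‖ ≤ M) (hy : ‖y‖ ≤ M) (n : ℕ) :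
    ‖x ^ n - y ^ n‖ ≤ n * M ^ n * ‖x - y‖ := by
  induction n with
  | zero => simp
  | succ n ih =>
    have hy' : ‖y ^ n‖ ≤ M ^ (n + 1) :=
      ((norm_pow_le y n).trans (by gcongr)).trans (pow_le_pow_right₀ hM n.le_succ)
    calc ‖x ^ (n + 1) - y ^ (n + 1)‖ = ‖x * (x ^ n - y ^ n) + (x - y) * y ^ n‖ := by
          rw [pow_succ', pow_succ']; noncomm_ring
      _ ≤ ‖x‖ * ‖x ^ n - y ^ n‖ + ‖x - y‖ * ‖y ^ n‖ :=
          (norm_add_le _ _).trans (add_le_add (norm_mul_le _ _) (norm_mul_le _ _))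
      _ ≤ M * (n * M ^ n * ‖x - y‖) + ‖x - y‖ * M ^ (n + 1) := by gcongr
      _ = (n + 1 : ℕ) * M ^ (n + 1) * ‖x - y‖ := by push_cast; ring

variable [NormedSpace ℝ 𝔸]

lemma eventually_norm_le_one_add {f : ℝ → 𝔸} {f' : 𝔸} (hf : HasDerivAt f f' 0) (hf0 : f 0 = 1) :
    ∀ᶠ s in 𝓝 (0 : ℝ), ‖f s‖ ≤ 1 + (‖f'‖ + 1) * |s| := by
  filter_upwards [(hasDerivAt_iff_isLittleO.mp hf).bound one_pos] with s hs
  rw [hf0, sub_zero, one_mul, Real.norm_eq_abs] at hs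
  calc ‖f s‖ = ‖(f s - 1 - s • f') + 1 + s • f'‖ := by congr 1; abel
    _ ≤ ‖f s - 1 - s • f'‖ + ‖(1 : 𝔸)‖ + ‖s • f'‖ := norm_add₃_le
    _ ≤ 1 + (‖f'‖ + 1) * |s| := by rw [norm_one, norm_smul, Real.norm_eq_abs]; linarith

lemma one_add_div_pow_le_exp {K : ℝ} (hK : 0 ≤ K) {N : ℕ} (hN : N ≠ 0) :
    (1 + K * (1 / N)) ^ N ≤ Real.exp K := by
  calc (1 + K * (1 / N : ℝ)) ^ N ≤ Real.exp (K * (1 / N)) ^ N := by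
        gcongr
        rw [add_comm]
        exact Real.add_one_le_exp _
    _ = Real.exp K := by rw [← Real.exp_nat_mul]; congr 1; field_simp

lemma tendsto_pow_sub_pow_of_hasDerivAt {f g : ℝ → 𝔸} {f' : 𝔸} (hf : HasDerivAt f f' 0)
    (hg : HasDerivAt g f' 0) (hf0 : f 0 = 1) (hg0 : g 0 = 1) :
    Tendsto (fun N : ℕ => f (1 / (N : ℝ)) ^ N - g (1 / (N : ℝ)) ^ N) atTop (𝓝 0) := by
  have ht : Tendsto (fun N : ℕ => 1 / (N : ℝ)) atTop (𝓝 0) := tendsto_one_div_atTop_nhds_zero_nat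
  set K := ‖f'‖ + 1
  refine Metric.tendsto_nhds.mpr fun δ hδ => ?_
  have hc : 0 < δ / (2 * Real.exp K) := by positivity
  have hfg := (hasDerivAt_iff_isLittleO.mp (hf.sub hg)).bound hc
  filter_upwards [ht.eventually (eventually_norm_le_one_add hf hf0),
    ht.eventually (eventually_norm_le_one_add hg hg0), ht.eventually hfg,
    eventually_gt_atTop 0] with N hfN hgN hfgN hN
  have habs : |1 / (N : ℝ)| = 1 / N := abs_of_nonneg (by positivity)
  simp only [Pi.sub_apply, sub_self, smul_zero, sub_zero, hf0, hg0, Real.norm_eq_abs, habs]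
    at hfN hgN hfgN
  have hM : 1 ≤ 1 + K * (1 / (N : ℝ)) := le_add_of_nonneg_right (by positivity)
  rw [dist_zero_right]
  calc ‖f (1 / (N : ℝ)) ^ N - g (1 / (N : ℝ)) ^ N‖
      ≤ N * (1 + K * (1 / (N : ℝ))) ^ N * ‖f (1 / (N : ℝ)) - g (1 / (N : ℝ))‖ :=
        norm_pow_sub_pow_le hM hfN hgN N
    _ ≤ N * Real.exp K * (δ / (2 * Real.exp K) * (1 / N)) := by
        gcongr
        exact one_add_div_pow_le_exp (by positivity) hN.ne'
    _ = δ / 2 := by field_simp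
    _ < δ := half_lt_self hδ

end LieTrotter

lemma exp_one_div_smul_pow {𝔸 : Type*} [NormedRing 𝔸] [NormedAlgebra ℝ 𝔸] [CompleteSpace 𝔸]
    (A : 𝔸) {N : ℕ} (hN : N ≠ 0) :
    NormedSpace.exp ((1 / (N : ℝ)) • A) ^ N = NormedSpace.exp A := by
  let _ : NormedAlgebra ℚ 𝔸 := NormedAlgebra.restrictScalars ℚ ℝ 𝔸
  rw [← NormedSpace.exp_nsmul, ← Nat.cast_smul_eq_nsmul ℝ, smul_smul,
    mul_one_div_cancel (Nat.cast_ne_zero.mpr hN), one_smul]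

open Filter Topology in
theorem tendsto_exp_mul_exp_pow {𝔸 : Type*} [NormedRing 𝔸] [NormOneClass 𝔸] [NormedAlgebra ℝ 𝔸]
    [CompleteSpace 𝔸] (A B : 𝔸) :
    Tendsto (fun N : ℕ => (NormedSpace.exp ((1 / (N : ℝ)) • A)
      * NormedSpace.exp ((1 / (N : ℝ)) • B)) ^ N) atTop (𝓝 (NormedSpace.exp (A + B))) := by
  have hderiv (C : 𝔸) : HasDerivAt (fun s : ℝ => NormedSpace.exp (s • C)) C 0 := by
    simpa using hasDerivAt_exp_smul_const (𝕂 := ℝ) C 0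
  have hmul : HasDerivAt (fun s : ℝ => NormedSpace.exp (s • A) * NormedSpace.exp (s • B))
      (A + B) 0 := by
    simpa only [zero_smul, NormedSpace.exp_zero, mul_one, one_mul, Pi.mul_def] using
      (hderiv A).mul (hderiv B)
  have hdiff := tendsto_pow_sub_pow_of_hasDerivAt hmul (hderiv (A + B)) (by simp) (by simp)
  have hconst : Tendsto (fun N : ℕ => NormedSpace.exp ((1 / (N : ℝ)) • (A + B)) ^ N) atTop
      (𝓝 (NormedSpace.exp (A + B))) := by
    refine tendsto_const_nhds.congr' ?_
    filter_upwards [eventually_gt_atTop 0] with N hN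
    exact (exp_one_div_smul_pow _ hN.ne').symm
  simpa using hdiff.add hconst

section GoldenThompson

open Matrix Filter Topology
open scoped Matrix.Norms.L2Operator

variable {ι κ : Type*} [Fintype ι] [Fintype κ]

lemma trace_transpose_mul_eq_sum (X Y : Matrix ι κ ℝ) :
    (Xᵀ * Y).trace = ∑ i, ∑ j, X i j * Y i j := by
  simp only [trace, diag, mul_apply, transpose_apply]
  exact Finset.sum_comm

lemma two_mul_abs_trace_transpose_mul_le (X Y : Matrix ι κ ℝ) :
    2 * |(Xᵀ * Y).trace| ≤ (Xᵀ * X).trace + (Yᵀ * Y).trace := by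
  simp only [trace_transpose_mul_eq_sum, ← Finset.sum_add_distrib]
  calc 2 * |∑ i, ∑ j, X i j * Y i j| ≤ 2 * ∑ i, ∑ j, |X i j * Y i j| := by
        gcongr
        exact (Finset.abs_sum_le_sum_abs _ _).trans
          (Finset.sum_le_sum fun i _ => Finset.abs_sum_le_sum_abs _ _)
    _ ≤ ∑ i, ∑ j, (X i j * X i j + Y i j * Y i j) := by
        simp only [Finset.mul_sum]
        gcongr with i _ j _
        have := two_mul_le_add_sq |X i j| |Y i j|
        rw [sq_abs, sq_abs, mul_assoc, ← abs_mul] at this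
        linarith

variable [DecidableEq ι]

lemma trace_mul_pow_comm {R : Type*} [CommSemiring R] (A B : Matrix ι ι R) (k : ℕ) :
    ((A * B) ^ k).trace = ((B * A) ^ k).trace := by
  cases k with
  | zero => simp
  | succ k => rw [pow_succ', mul_assoc, trace_mul_comm, mul_assoc, mul_pow_mul, trace_mul_comm,
      mul_assoc, ← mul_assoc, trace_mul_comm, ← mul_assoc, ← pow_succ']

lemma abs_trace_pow_two_mul_succ_le {p : ℕ}
    (hpow : ∀ X : Matrix ι ι ℝ, |(X ^ (2 * p)).trace| ≤ ((Xᵀ * X) ^ p).trace)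
    (hmul : ∀ A B : Matrix ι ι ℝ, A.IsSymm → B.IsSymm →
      |((A * B) ^ p).trace| ≤ |(A ^ p * B ^ p).trace|) (X : Matrix ι ι ℝ) :
    |(X ^ (2 * (2 * p))).trace| ≤ ((Xᵀ * X) ^ (2 * p)).trace := by
  have hP : (Xᵀ * X).IsSymm := isSymm_transpose_mul_self X
  have hQ : (X * Xᵀ).IsSymm := isSymm_mul_transpose_self X
  calc |(X ^ (2 * (2 * p))).trace| = |((X ^ 2) ^ (2 * p)).trace| := by rw [← pow_mul]
    _ ≤ (((X ^ 2)ᵀ * X ^ 2) ^ p).trace := hpow _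
    _ = ((Xᵀ * (Xᵀ * X * X)) ^ p).trace := by
        simp only [sq, transpose_mul, Matrix.mul_assoc]
    _ = ((Xᵀ * X * (X * Xᵀ)) ^ p).trace := by rw [trace_mul_pow_comm, Matrix.mul_assoc]
    _ ≤ |((Xᵀ * X) ^ p * (X * Xᵀ) ^ p).trace| := (le_abs_self _).trans (hmul _ _ hP hQ)
    _ ≤ ((Xᵀ * X) ^ (2 * p)).trace := by
        have h := two_mul_abs_trace_transpose_mul_le ((Xᵀ * X) ^ p) ((X * Xᵀ) ^ p)
        rw [transpose_pow, hP.eq, transpose_pow, hQ.eq, ← pow_add, ← pow_add,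
          trace_mul_pow_comm X, ← two_mul p] at h
        linarith

lemma abs_trace_mul_pow_two_mul_le {p : ℕ}
    (hpow : ∀ X : Matrix ι ι ℝ, |(X ^ (2 * p)).trace| ≤ ((Xᵀ * X) ^ p).trace)
    (hmul : ∀ A B : Matrix ι ι ℝ, A.IsSymm → B.IsSymm →
      |((A * B) ^ p).trace| ≤ |(A ^ p * B ^ p).trace|) {A B : Matrix ι ι ℝ} (hA : A.IsSymm)
    (hB : B.IsSymm) : |((A * B) ^ (2 * p)).trace| ≤ |(A ^ (2 * p) * B ^ (2 * p)).trace| :=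
  calc |((A * B) ^ (2 * p)).trace| ≤ (((A * B)ᵀ * (A * B)) ^ p).trace := hpow _
    _ = ((B * (A * A * B)) ^ p).trace := by
        rw [transpose_mul, hA.eq, hB.eq]; simp only [Matrix.mul_assoc]
    _ = ((A ^ 2 * B ^ 2) ^ p).trace := by
        rw [trace_mul_pow_comm, sq, sq]; simp only [Matrix.mul_assoc]
    _ ≤ |((A ^ 2) ^ p * (B ^ 2) ^ p).trace| :=
        (le_abs_self _).trans (hmul _ _ (hA.pow 2) (hB.pow 2))
    _ = |(A ^ (2 * p) * B ^ (2 * p)).trace| := by rw [pow_mul, pow_mul]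

lemma abs_trace_pow_two_pow_le (k : ℕ) :
    (∀ X : Matrix ι ι ℝ, |(X ^ (2 * 2 ^ k)).trace| ≤ ((Xᵀ * X) ^ 2 ^ k).trace) ∧
    ∀ A B : Matrix ι ι ℝ, A.IsSymm → B.IsSymm →
      |((A * B) ^ 2 ^ k).trace| ≤ |(A ^ 2 ^ k * B ^ 2 ^ k).trace| := by
  induction k with
  | zero =>
    refine ⟨fun X => ?_, fun A B _ _ => by simp⟩
    have h := two_mul_abs_trace_transpose_mul_le Xᵀ X
    rw [transpose_transpose, trace_mul_comm X Xᵀ, ← sq] at h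
    simp only [pow_zero, mul_one, pow_one]
    linarith
  | succ k ih =>
    rw [pow_succ']
    exact ⟨abs_trace_pow_two_mul_succ_le ih.1 ih.2,
      fun A B => abs_trace_mul_pow_two_mul_le ih.1 ih.2⟩

theorem trace_exp_add_le_abs {A B : Matrix ι ι ℝ} (hA : A.IsSymm) (hB : B.IsSymm) :
    (NormedSpace.exp (A + B)).trace ≤ |(NormedSpace.exp A * NormedSpace.exp B).trace| := by
  rcases isEmpty_or_nonempty ι with _ | _
  · simp [trace]
  have hlim := (tendsto_exp_mul_exp_pow A B).comp (tendsto_pow_atTop_atTop_of_one_lt one_lt_two)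
  have htrace : Continuous (fun M : Matrix ι ι ℝ => M.trace) := continuous_id.matrix_trace
  refine le_of_tendsto ((htrace.tendsto _).comp hlim) (Eventually.of_forall fun k => ?_)
  have hsymm {M : Matrix ι ι ℝ} (hM : M.IsSymm) :
      (NormedSpace.exp ((1 / ((2 ^ k : ℕ) : ℝ)) • M)).IsSymm := (hM.smul _).exp
  have hbound := (abs_trace_pow_two_pow_le k).2 _ _ (hsymm hA) (hsymm hB)
  rw [exp_one_div_smul_pow _ (by positivity), exp_one_div_smul_pow _ (by positivity)] at hbound
  exact (le_abs_self _).trans hbound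

end GoldenThompson

lemma exp_le_one_add_add_mul_sq {a x : ℝ} (ha : 0 < a) (hx : |x| ≤ a) :
    Real.exp x ≤ 1 + x + (Real.exp a - 1 - a) / a ^ 2 * x ^ 2 := by
  have hseries (z : ℝ) :
      HasSum (fun k : ℕ => z ^ (k + 2) / (k + 2).factorial) (Real.exp z - 1 - z) := by
    rw [Real.exp_eq_exp_ℝ]
    simpa [Finset.sum_range_succ, sub_sub] using
      (hasSum_nat_add_iff' 2).mpr (NormedSpace.expSeries_div_hasSum_exp z)
  have hterm (k : ℕ) : x ^ (k + 2) / (k + 2).factorial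
      ≤ x ^ 2 / a ^ 2 * (a ^ (k + 2) / (k + 2).factorial) := by
    have hk : x ^ k ≤ a ^ k := (le_abs_self _).trans (by rw [abs_pow]; gcongr)
    calc x ^ (k + 2) / (k + 2).factorial = x ^ 2 * x ^ k / (k + 2).factorial := by ring
      _ ≤ x ^ 2 * a ^ k / (k + 2).factorial := by gcongr
      _ = x ^ 2 / a ^ 2 * (a ^ (k + 2) / (k + 2).factorial) := by rw [pow_add]; field_simp
  have hle := hasSum_le hterm (hseries x) ((hseries a).mul_left (x ^ 2 / a ^ 2))
  have hcomm : (Real.exp a - 1 - a) / a ^ 2 * x ^ 2 = x ^ 2 / a ^ 2 * (Real.exp a - 1 - a) := by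
    ring
  linarith

section TraceExp

open Matrix
open scoped Matrix.Norms.L2Operator

variable {ι : Type*}

lemma isSelfAdjoint_iff_isSymm {A : Matrix ι ι ℝ} : IsSelfAdjoint A ↔ A.IsSymm := by
  rw [isSelfAdjoint_iff, star_eq_conjTranspose, conjTranspose_eq_transpose_of_trivial, IsSymm]

variable [Fintype ι] [DecidableEq ι]

omit [DecidableEq ι] in
lemma trace_mul_nonneg {A B : Matrix ι ι ℝ} (hA : 0 ≤ A) (hB : 0 ≤ B) : 0 ≤ (A * B).trace := by
  classical
  obtain ⟨X, rfl⟩ := CStarAlgebra.nonneg_iff_eq_star_mul_self.mp hA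
  rw [mul_assoc, trace_mul_comm]
  exact (star_right_conjugate_nonneg hB X).posSemidef.trace_nonneg

omit [DecidableEq ι] in
lemma trace_mul_le_trace_mul {A B C : Matrix ι ι ℝ} (hA : 0 ≤ A) (hBC : B ≤ C) :
    (A * B).trace ≤ (A * C).trace := by
  simpa only [Matrix.mul_sub, trace_sub, sub_nonneg] using trace_mul_nonneg hA (sub_nonneg.mpr hBC)

theorem trace_exp_add_le {A B : Matrix ι ι ℝ} (hA : IsSelfAdjoint A) (hB : IsSelfAdjoint B) :
    (NormedSpace.exp (A + B)).trace ≤ (NormedSpace.exp A * NormedSpace.exp B).trace := by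
  have h := trace_exp_add_le_abs (isSelfAdjoint_iff_isSymm.mp hA) (isSelfAdjoint_iff_isSymm.mp hB)
  rwa [abs_of_nonneg (trace_mul_nonneg hA.exp_nonneg hB.exp_nonneg)] at h

lemma trace_cfc {A : Matrix ι ι ℝ} (hA : A.IsHermitian) (f : ℝ → ℝ) :
    (cfc f A).trace = ∑ i, f (hA.eigenvalues i) := by
  simp [hA.cfc_eq, IsHermitian.cfc, Unitary.conjStarAlgAut_apply, trace_mul_comm, ← mul_assoc,
    trace_diagonal]

lemma exp_le_trace_exp {A : Matrix ι ι ℝ} (hA : IsSelfAdjoint A) {x : ℝ} (hx : x ∈ spectrum ℝ A) :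
    Real.exp x ≤ (NormedSpace.exp A).trace := by
  have hA' : A.IsHermitian := hA
  rw [hA'.spectrum_real_eq_range_eigenvalues] at hx
  obtain ⟨i, rfl⟩ := hx
  rw [← CFC.real_exp_eq_normedSpace_exp hA, trace_cfc hA']
  exact Finset.single_le_sum (f := fun i => Real.exp (hA'.eigenvalues i))
    (fun j _ => (Real.exp_pos _).le) (Finset.mem_univ i)

lemma exp_norm_le_max_trace_exp [Nonempty ι] {A : Matrix ι ι ℝ} (hA : IsSelfAdjoint A) :
    Real.exp ‖A‖ ≤ max (NormedSpace.exp A).trace (NormedSpace.exp (-A)).trace := by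
  obtain ⟨x, hx, hxA⟩ :=
    (IsometricContinuousFunctionalCalculus.isGreatest_norm_spectrum (𝕜 := ℝ) A hA).1
  simp only [Real.norm_eq_abs] at hxA
  rw [← hxA]
  rcases abs_cases x with ⟨h, _⟩ | ⟨h, _⟩
  · rw [h]
    exact le_max_of_le_left (exp_le_trace_exp hA hx)
  · rw [h]
    exact le_max_of_le_right (exp_le_trace_exp hA.neg (by rwa [← spectrum.neg_eq, Set.neg_mem_neg]))

lemma exp_le_one_add_add_smul_sq {A : Matrix ι ι ℝ} (hA : IsSelfAdjoint A) {a : ℝ} (ha : 0 < a)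
    (hAa : ‖A‖ ≤ a) :
    NormedSpace.exp A ≤ 1 + A + ((Real.exp a - 1 - a) / a ^ 2) • A ^ 2 := by
  rcases isEmpty_or_nonempty ι with _ | _
  · exact (Subsingleton.elim _ _).le
  have hcfc : cfc (fun x : ℝ => 1 + x + ((Real.exp a - 1 - a) / a ^ 2) * x ^ 2) A
      = 1 + A + ((Real.exp a - 1 - a) / a ^ 2) • A ^ 2 := by
    rw [cfc_add .., cfc_add .., cfc_const_mul .., cfc_pow_id .., cfc_const_one .., cfc_id' ..]
  rw [← CFC.real_exp_eq_normedSpace_exp hA, ← hcfc]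
  exact cfc_mono fun x hx =>
    exp_le_one_add_add_mul_sq ha ((spectrum.norm_le_norm_of_mem hx).trans hAa)

end TraceExp

section Dilation

open Matrix
open scoped Matrix.Norms.L2Operator

variable {ι κ : Type*}

/-- The self-adjoint dilation `[[0, M], [Mᵀ, 0]]` of a rectangular matrix. It has the norm of `M`
and a symmetric spectrum, and so reduces norm bounds for `M` to the self-adjoint case. -/
def dilation : Matrix ι κ ℝ →ₗ[ℝ] Matrix (ι ⊕ κ) (ι ⊕ κ) ℝ where
  toFun M := fromBlocks 0 M Mᵀ 0
  map_add' M N := by simp [fromBlocks_add]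
  map_smul' c M := by simp [fromBlocks_smul]

lemma dilation_apply (M : Matrix ι κ ℝ) : dilation M = fromBlocks 0 M Mᵀ 0 := rfl

lemma isSelfAdjoint_dilation (M : Matrix ι κ ℝ) : IsSelfAdjoint (dilation M) := by
  simp [isSelfAdjoint_iff_isSymm, IsSymm, dilation_apply, fromBlocks_transpose]

variable [Fintype ι] [Fintype κ] [DecidableEq ι] [DecidableEq κ]

lemma dilation_sq (M : Matrix ι κ ℝ) :
    dilation M ^ 2 = fromBlocks (M * Mᵀ) 0 0 (Mᵀ * M) := by
  simp [sq, dilation_apply, fromBlocks_multiply]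

omit [DecidableEq ι] in
lemma norm_le_iff_sum_sq_mulVec_le {M : Matrix ι κ ℝ} {C : ℝ} (hC : 0 ≤ C) :
    ‖M‖ ≤ C ↔ ∀ x : κ → ℝ, ∑ i, (M *ᵥ x) i ^ 2 ≤ C ^ 2 * ∑ k, x k ^ 2 := by
  have hsq (x : κ → ℝ) : ‖toEuclideanLin M (WithLp.toLp 2 x)‖ ≤ C * ‖WithLp.toLp 2 x‖ ↔
      ∑ i, (M *ᵥ x) i ^ 2 ≤ C ^ 2 * ∑ k, x k ^ 2 := by
    rw [← sq_le_sq₀ (norm_nonneg _) (by positivity), mul_pow, EuclideanSpace.real_norm_sq_eq,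
      EuclideanSpace.real_norm_sq_eq]
    rfl
  rw [l2_opNorm_def, ContinuousLinearMap.opNorm_le_iff hC]
  exact ⟨fun h x => (hsq x).mp (h _), fun h x => (hsq x.ofLp).mpr (h _)⟩

lemma norm_dilation (M : Matrix ι κ ℝ) : ‖dilation M‖ = ‖M‖ := by
  have hiff {C : ℝ} (hC : 0 ≤ C) : ‖dilation M‖ ≤ C ↔ ‖M‖ ≤ C := by
    constructor
    · intro h
      rw [norm_le_iff_sum_sq_mulVec_le hC] at h ⊢
      intro x
      simpa [dilation_apply, fromBlocks_mulVec] using h (Sum.elim 0 x)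
    · intro h
      have hT : ‖Mᵀ‖ ≤ C := by
        rwa [← conjTranspose_eq_transpose_of_trivial, l2_opNorm_conjTranspose]
      rw [norm_le_iff_sum_sq_mulVec_le hC] at h hT ⊢
      intro x
      have h₁ := h (x ∘ Sum.inr)
      have h₂ := hT (x ∘ Sum.inl)
      simp only [Function.comp_apply, dilation_apply, fromBlocks_mulVec, zero_mulVec, zero_add,
        add_zero, Fintype.sum_sum_type, Sum.elim_inl, Sum.elim_inr] at h₁ h₂ ⊢
      linarith
  exact le_antisymm ((hiff (norm_nonneg _)).mpr le_rfl) ((hiff (norm_nonneg _)).mp le_rfl)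

lemma trace_exp_neg_dilation (M : Matrix ι κ ℝ) :
    (NormedSpace.exp (-dilation M)).trace = (NormedSpace.exp (dilation M)).trace := by
  set J : Matrix (ι ⊕ κ) (ι ⊕ κ) ℝ := fromBlocks 1 0 0 (-1)
  have hJ : J * J = 1 := by simp [J, fromBlocks_multiply]
  have hJinv : J⁻¹ = J := inv_eq_left_inv hJ
  have hconj : -dilation M = J * dilation M * J⁻¹ := by
    simp [hJinv, J, dilation_apply, fromBlocks_multiply, fromBlocks_neg]
  rw [hconj, exp_conj J _ (.of_mul_eq_one _ hJ), hJinv, trace_mul_cycle, hJ, one_mul]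

lemma exp_norm_le_trace_exp_dilation [Nonempty ι] (M : Matrix ι κ ℝ) :
    Real.exp ‖M‖ ≤ (NormedSpace.exp (dilation M)).trace := by
  simpa only [norm_dilation, trace_exp_neg_dilation, max_self] using
    exp_norm_le_max_trace_exp (isSelfAdjoint_dilation M)

end Dilation

lemma integrable_comp_of_norm_le {Ω E F : Type*} {mΩ : MeasurableSpace Ω} {μ : Measure Ω}
    [IsFiniteMeasure μ] [NormedAddCommGroup E] [ProperSpace E] [NormedAddCommGroup F]
    {f : Ω → E} (hf : AEStronglyMeasurable f μ) {R : ℝ} (hfR : ∀ᵐ ω ∂μ, ‖f ω‖ ≤ R)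
    {g : E → F} (hg : Continuous g) : Integrable (fun ω => g (f ω)) μ := by
  obtain ⟨C, hC⟩ := (isCompact_closedBall (0 : E) R).exists_bound_of_continuousOn hg.continuousOn
  refine .of_bound (hg.comp_aestronglyMeasurable hf) C ?_
  filter_upwards [hfR] with ω hω
  exact hC _ (mem_closedBall_zero_iff.mpr hω)

/-- The entrywise σ-algebra on matrices; it is the Borel σ-algebra for countable index types. -/
local instance matrixMeasurableSpace {ι κ : Type*} : MeasurableSpace (Matrix ι κ ℝ) :=
  inferInstanceAs (MeasurableSpace (ι → κ → ℝ))

local instance matrixBorelSpace {ι κ : Type*} [Countable ι] [Countable κ] :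
    BorelSpace (Matrix ι κ ℝ) :=
  inferInstanceAs (BorelSpace (ι → κ → ℝ))

local instance matrixOrderClosedTopology {ι : Type*} [Fintype ι] :
    OrderClosedTopology (Matrix ι ι ℝ) where
  isClosed_le' := isClosed_le_of_isClosed_nonneg <| by
    simp only [Matrix.nonneg_iff_posSemidef, Matrix.posSemidef_iff_dotProduct_mulVec,
      Set.ofPred_and, Set.ofPred_forall, Matrix.IsHermitian]
    exact (isClosed_eq (by fun_prop) continuous_id).inter
      (isClosed_iInter fun x => isClosed_le continuous_const (by fun_prop))

section MatrixBernstein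

open Matrix
open scoped Matrix.Norms.L2Operator

variable {Ω ι : Type*} {mΩ : MeasurableSpace Ω} {μ : Measure Ω} [Fintype ι] [DecidableEq ι]

lemma integrable_trace {A : Ω → Matrix ι ι ℝ} (hA : Integrable A μ) :
    Integrable (fun ω => (A ω).trace) μ :=
  (traceLinearMap ι ℝ ℝ).toContinuousLinearMap.integrable_comp hA

lemma integral_trace {A : Ω → Matrix ι ι ℝ} (hA : Integrable A μ) :
    ∫ ω, (A ω).trace ∂μ = (∫ ω, A ω ∂μ).trace :=
  (traceLinearMap ι ℝ ℝ).toContinuousLinearMap.integral_comp_comm hA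

lemma continuous_matrix_exp : Continuous (NormedSpace.exp : Matrix ι ι ℝ → Matrix ι ι ℝ) :=
  letI := NormedAlgebra.restrictScalars ℚ ℝ (Matrix ι ι ℝ)
  NormedSpace.exp_continuous

lemma integral_exp_le [IsProbabilityMeasure μ] {H : Ω → Matrix ι ι ℝ} {a v : ℝ} (ha : 0 < a)
    (hmeas : AEStronglyMeasurable H μ) (hself : ∀ ω, IsSelfAdjoint (H ω))
    (hmean : ∫ ω, H ω ∂μ = 0) (hbound : ∀ᵐ ω ∂μ, ‖H ω‖ ≤ a)
    (hvar : ∫ ω, H ω ^ 2 ∂μ ≤ v • 1) :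
    ∫ ω, NormedSpace.exp (H ω) ∂μ
      ≤ Real.exp ((Real.exp a - 1 - a) / a ^ 2 * v) • (1 : Matrix ι ι ℝ) := by
  set ψ := (Real.exp a - 1 - a) / a ^ 2
  have hψ : 0 ≤ ψ := div_nonneg (by linarith [Real.add_one_le_exp a]) (sq_nonneg a)
  have hH : Integrable H μ := integrable_comp_of_norm_le hmeas hbound continuous_id
  have hH2 : Integrable (fun ω => H ω ^ 2) μ :=
    integrable_comp_of_norm_le hmeas hbound (continuous_pow 2)
  calc ∫ ω, NormedSpace.exp (H ω) ∂μ
      ≤ ∫ ω, (1 + H ω + ψ • H ω ^ 2) ∂μ := by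
        refine integral_mono_ae
          (integrable_comp_of_norm_le hmeas hbound continuous_matrix_exp)
          (((integrable_const _).add hH).add (hH2.smul ψ)) ?_
        filter_upwards [hbound] with ω hω
        exact exp_le_one_add_add_smul_sq (hself ω) ha hω
    _ = 1 + ψ • ∫ ω, H ω ^ 2 ∂μ := by
        rw [integral_add (by exact (integrable_const _).add hH) (by exact hH2.smul ψ),
          integral_add (integrable_const _) hH, integral_smul, hmean]
        simp
    _ ≤ 1 + ψ • v • 1 := by gcongr
    _ = (ψ * v + 1) • 1 := by rw [smul_smul, add_smul, one_smul, add_comm]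
    _ ≤ Real.exp (ψ * v) • 1 := by
        gcongr
        exact Real.add_one_le_exp _

lemma integrable_exp_sum [IsFiniteMeasure μ] {τ : Type*} {H : τ → Ω → Matrix ι ι ℝ} {a : ℝ}
    (hmeas : ∀ j, Measurable (H j)) (hbound : ∀ j, ∀ᵐ ω ∂μ, ‖H j ω‖ ≤ a) (s : Finset τ) :
    Integrable (fun ω => NormedSpace.exp (∑ j ∈ s, H j ω)) μ := by
  refine integrable_comp_of_norm_le (R := s.card * a)
    (Finset.measurable_fun_sum s fun j _ => hmeas j).aestronglyMeasurable ?_ continuous_matrix_exp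
  filter_upwards [(ae_ball_iff s.countable_toSet).mpr fun j _ => hbound j] with ω hω
  simpa using norm_sum_le_of_le s hω

lemma integral_trace_exp_sum_le [IsProbabilityMeasure μ] {τ : Type*} {H : τ → Ω → Matrix ι ι ℝ}
    {a κ : ℝ} (hindep : iIndepFun H μ) (hmeas : ∀ j, Measurable (H j))
    (hself : ∀ j ω, IsSelfAdjoint (H j ω)) (hbound : ∀ j, ∀ᵐ ω ∂μ, ‖H j ω‖ ≤ a)
    (hexp : ∀ j, ∫ ω, NormedSpace.exp (H j ω) ∂μ ≤ Real.exp κ • (1 : Matrix ι ι ℝ))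
    (s : Finset τ) :
    ∫ ω, (NormedSpace.exp (∑ j ∈ s, H j ω)).trace ∂μ
      ≤ Fintype.card ι * Real.exp (s.card * κ) := by
  have hexpInt := integrable_exp_sum hmeas hbound
  classical
  induction s using Finset.induction_on with
  | empty => simp
  | insert j s hj ih =>
    have hjInt : Integrable (fun ω => NormedSpace.exp (H j ω)) μ := by simpa using hexpInt {j}
    have hind : IndepFun (fun ω => NormedSpace.exp (H j ω))
        (fun ω => NormedSpace.exp (∑ i ∈ s, H i ω)) μ := by
      have h := (hindep.indepFun_finsetSum_of_notMem hmeas hj).symm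
      simpa only [Function.comp_def, Finset.sum_apply] using h.comp
        continuous_matrix_exp.measurable continuous_matrix_exp.measurable
    have hself_sum ω : IsSelfAdjoint (∑ i ∈ s, H i ω) := isSelfAdjoint_sum s fun i _ => hself i ω
    have hprod := hind.integral_bilin hjInt (hexpInt s) (ContinuousLinearMap.mul ℝ (Matrix ι ι ℝ))
    have hprodInt :=
      hind.integrable_bilin hjInt (hexpInt s) (ContinuousLinearMap.mul ℝ (Matrix ι ι ℝ))
    simp only [ContinuousLinearMap.mul_apply'] at hprod hprodInt
    calc ∫ ω, (NormedSpace.exp (∑ i ∈ insert j s, H i ω)).trace ∂μ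
        ≤ ∫ ω, (NormedSpace.exp (H j ω) * NormedSpace.exp (∑ i ∈ s, H i ω)).trace ∂μ := by
          refine integral_mono (integrable_trace (hexpInt _)) (integrable_trace hprodInt)
            fun ω => ?_
          simpa only [Finset.sum_insert hj] using trace_exp_add_le (hself j ω) (hself_sum ω)
      _ = ((∫ ω, NormedSpace.exp (H j ω) ∂μ)
            * ∫ ω, NormedSpace.exp (∑ i ∈ s, H i ω) ∂μ).trace := by
          rw [integral_trace hprodInt, hprod]
      _ ≤ (Real.exp κ • 1 * ∫ ω, NormedSpace.exp (∑ i ∈ s, H i ω) ∂μ).trace := by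
          rw [trace_mul_comm, trace_mul_comm (Real.exp κ • 1)]
          exact trace_mul_le_trace_mul (integral_nonneg fun ω => (hself_sum ω).exp_nonneg) (hexp j)
      _ = Real.exp κ * ∫ ω, (NormedSpace.exp (∑ i ∈ s, H i ω)).trace ∂μ := by
          rw [smul_mul_assoc, one_mul, trace_smul, smul_eq_mul, integral_trace (hexpInt s)]
      _ ≤ Real.exp κ * (Fintype.card ι * Real.exp (s.card * κ)) := by gcongr
      _ = Fintype.card ι * Real.exp ((insert j s).card * κ) := by
          rw [Finset.card_insert_of_notMem hj, Nat.cast_succ, add_one_mul, Real.exp_add]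
          ring

variable {κ τ : Type*} [Fintype κ] [Fintype τ] [DecidableEq κ]

omit [DecidableEq ι] in
lemma integral_matrix_apply {A : Ω → Matrix ι κ ℝ} (hA : Integrable A μ) (i : ι) (j : κ) :
    (∫ ω, A ω ∂μ) i j = ∫ ω, A ω i j ∂μ :=
  ((entryLinearMap ℝ ℝ i j).toContinuousLinearMap.integral_comp_comm hA).symm

omit [DecidableEq ι] [DecidableEq κ] in
lemma posSemidef_fromBlocks_zero {A : Matrix ι ι ℝ} {B : Matrix κ κ ℝ} (hA : A.PosSemidef)
    (hB : B.PosSemidef) : (fromBlocks A 0 0 B).PosSemidef := by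
  classical
  obtain ⟨X, rfl⟩ := CStarAlgebra.nonneg_iff_eq_star_mul_self.mp hA.nonneg
  obtain ⟨Y, rfl⟩ := CStarAlgebra.nonneg_iff_eq_star_mul_self.mp hB.nonneg
  simpa [fromBlocks_transpose, fromBlocks_multiply, star_eq_conjTranspose] using
    posSemidef_conjTranspose_mul_self (fromBlocks X 0 0 Y)

lemma integral_dilation_sq_le [IsProbabilityMeasure μ] {Z : Ω → Matrix ι κ ℝ} {R σ : ℝ}
    (hmeas : AEStronglyMeasurable Z μ) (hbound : ∀ᵐ ω ∂μ, ‖Z ω‖ ≤ R)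
    (hrow : ∫ ω, Z ω * (Z ω)ᵀ ∂μ ≤ σ • 1)
    (hcol : ∫ ω, (Z ω)ᵀ * Z ω ∂μ ≤ σ • 1) :
    ∫ ω, dilation (Z ω) ^ 2 ∂μ ≤ σ • 1 := by
  have hsqInt : Integrable (fun ω => dilation (Z ω) ^ 2) μ :=
    integrable_comp_of_norm_le (g := fun M => dilation M ^ 2) hmeas hbound
      (dilation.continuous_of_finiteDimensional.pow 2)
  simp only [dilation_sq] at hsqInt ⊢
  have hrowInt : Integrable (fun ω => Z ω * (Z ω)ᵀ) μ :=
    integrable_comp_of_norm_le (g := fun M => M * Mᵀ) hmeas hbound (by fun_prop)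
  have hcolInt : Integrable (fun ω => (Z ω)ᵀ * Z ω) μ :=
    integrable_comp_of_norm_le (g := fun M => Mᵀ * M) hmeas hbound (by fun_prop)
  have hblocks : σ • 1 - ∫ ω, fromBlocks (Z ω * (Z ω)ᵀ) 0 0 ((Z ω)ᵀ * Z ω) ∂μ
      = fromBlocks (σ • 1 - ∫ ω, Z ω * (Z ω)ᵀ ∂μ) 0 0 (σ • 1 - ∫ ω, (Z ω)ᵀ * Z ω ∂μ) := by
    ext (i | i) (j | j) <;>
      simp [integral_matrix_apply hsqInt, integral_matrix_apply hrowInt,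
        integral_matrix_apply hcolInt, one_apply]
  rw [le_iff, hblocks]
  exact posSemidef_fromBlocks_zero hrow hcol

lemma norm_dilation_smul_le {M : Matrix ι κ ℝ} {R θ a : ℝ} (hθ : 0 ≤ θ) (hθR : θ * R ≤ a)
    (hM : ‖M‖ ≤ R) : ‖dilation (θ • M)‖ ≤ a := by
  rw [norm_dilation, norm_smul, Real.norm_of_nonneg hθ]
  exact (mul_le_mul_of_nonneg_left hM hθ).trans hθR

lemma integral_trace_exp_sum_dilation_le [IsProbabilityMeasure μ] {Z : τ → Ω → Matrix ι κ ℝ}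
    {R σ θ a : ℝ} (hindep : iIndepFun Z μ) (hmeas : ∀ j, Measurable (Z j))
    (hmean : ∀ j, ∫ ω, Z j ω ∂μ = 0) (hbound : ∀ j, ∀ᵐ ω ∂μ, ‖Z j ω‖ ≤ R)
    (hrow : ∀ j, ∫ ω, Z j ω * (Z j ω)ᵀ ∂μ ≤ σ • 1) (hcol : ∀ j, ∫ ω, (Z j ω)ᵀ * Z j ω ∂μ ≤ σ • 1)
    (hθ : 0 ≤ θ) (ha : 0 < a) (hθR : θ * R ≤ a) :
    ∫ ω, (NormedSpace.exp (∑ j, dilation (θ • Z j ω))).trace ∂μ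
      ≤ (Fintype.card ι + Fintype.card κ) *
        Real.exp (Fintype.card τ * ((Real.exp a - 1 - a) / a ^ 2 * (θ ^ 2 * σ))) := by
  have hcont : Measurable fun M : Matrix ι κ ℝ => dilation (θ • M) :=
    (dilation.continuous_of_finiteDimensional.comp (continuous_const_smul θ)).measurable
  have hself j ω : IsSelfAdjoint (dilation (θ • Z j ω)) := isSelfAdjoint_dilation _
  have hbound' j : ∀ᵐ ω ∂μ, ‖dilation (θ • Z j ω)‖ ≤ a :=
    (hbound j).mono fun ω => norm_dilation_smul_le hθ hθR
  have hmean' j : ∫ ω, dilation (θ • Z j ω) ∂μ = 0 := by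
    have hZ : Integrable (Z j) μ :=
      integrable_comp_of_norm_le (hmeas j).aestronglyMeasurable (hbound j) continuous_id
    have h := (dilation (ι := ι) (κ := κ)).toContinuousLinearMap.integral_comp_comm (hZ.smul θ)
    simpa [integral_smul, hmean j] using h
  have hvar j : ∫ ω, dilation (θ • Z j ω) ^ 2 ∂μ ≤ (θ ^ 2 * σ) • 1 := by
    have h := integral_dilation_sq_le (hmeas j).aestronglyMeasurable (hbound j) (hrow j) (hcol j)
    simp only [map_smul, smul_pow, integral_smul, mul_smul]
    gcongr
  have h := integral_trace_exp_sum_le (hindep.comp _ fun _ => hcont)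
    (fun j => hcont.comp (hmeas j)) hself hbound'
    (fun j => integral_exp_le ha (hcont.comp (hmeas j)).aestronglyMeasurable (hself j) (hmean' j)
      (hbound' j) (hvar j)) Finset.univ
  simpa using h

theorem measureReal_le_norm_sum_le [IsProbabilityMeasure μ] [Nonempty ι]
    {Z : τ → Ω → Matrix ι κ ℝ} {R σ θ a : ℝ} (hindep : iIndepFun Z μ)
    (hmeas : ∀ j, Measurable (Z j)) (hmean : ∀ j, ∫ ω, Z j ω ∂μ = 0)
    (hbound : ∀ j, ∀ᵐ ω ∂μ, ‖Z j ω‖ ≤ R) (hrow : ∀ j, ∫ ω, Z j ω * (Z j ω)ᵀ ∂μ ≤ σ • 1)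
    (hcol : ∀ j, ∫ ω, (Z j ω)ᵀ * Z j ω ∂μ ≤ σ • 1) (hθ : 0 ≤ θ) (ha : 0 < a) (hθR : θ * R ≤ a)
    (y : ℝ) :
    μ.real {ω | y ≤ ‖∑ j, Z j ω‖} ≤ (Fintype.card ι + Fintype.card κ) *
      Real.exp (Fintype.card τ * ((Real.exp a - 1 - a) / a ^ 2 * (θ ^ 2 * σ)) - θ * y) := by
  have hlaplace ω :
      Real.exp (θ * ‖∑ j, Z j ω‖) ≤ (NormedSpace.exp (∑ j, dilation (θ • Z j ω))).trace := by
    rw [← map_sum, ← Finset.smul_sum, ← Real.norm_of_nonneg hθ, ← norm_smul,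
      Real.norm_of_nonneg hθ]
    exact exp_norm_le_trace_exp_dilation _
  have hint := integrable_trace <| integrable_exp_sum
    (fun j => (dilation.continuous_of_finiteDimensional.comp
      (continuous_const_smul θ)).measurable.comp (hmeas j))
    (fun j => (hbound j).mono fun ω => norm_dilation_smul_le hθ hθR) Finset.univ
  calc μ.real {ω | y ≤ ‖∑ j, Z j ω‖}
      ≤ μ.real {ω | Real.exp (θ * y) ≤ (NormedSpace.exp (∑ j, dilation (θ • Z j ω))).trace} :=
        measureReal_mono fun ω hω =>
          (Real.exp_le_exp.mpr (mul_le_mul_of_nonneg_left hω hθ)).trans (hlaplace ω)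
    _ ≤ (∫ ω, (NormedSpace.exp (∑ j, dilation (θ • Z j ω))).trace ∂μ) / Real.exp (θ * y) := by
        rw [le_div_iff₀' (Real.exp_pos _)]
        exact mul_meas_ge_le_integral_of_nonneg
          (ae_of_all _ fun ω => (Real.exp_pos _).le.trans (hlaplace ω)) hint _
    _ ≤ _ := by
        rw [Real.exp_sub, ← mul_div_assoc]
        gcongr
        exact integral_trace_exp_sum_dilation_le hindep hmeas hmean hbound hrow hcol hθ ha hθR

end MatrixBernstein

lemma mul_exp_one_sub_two_div_le {N v s d ρ : ℝ} (hs : 0 < s) (hd : 0 ≤ d) (hρ : 0 < ρ)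
    (hdv : d ^ 2 * s = N * v) :
    N * ((Real.exp 1 - 1 - 1) / 1 ^ 2 * ((1 / (d + 2 * ρ)) ^ 2 * v)) ≤ s :=
  calc N * ((Real.exp 1 - 1 - 1) / 1 ^ 2 * ((1 / (d + 2 * ρ)) ^ 2 * v))
      = (Real.exp 1 - 2) * (d / (d + 2 * ρ)) ^ 2 * s := by
        linear_combination (2 - Real.exp 1) * (1 / (d + 2 * ρ)) ^ 2 * hdv
    _ ≤ 1 * 1 ^ 2 * s := by
        gcongr
        · linarith [Real.exp_one_lt_d9]
        · exact (div_le_one (by positivity)).mpr (by linarith)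
    _ = s := by ring

section CentredSums

open Matrix
open scoped Matrix.Norms.L2Operator

variable {Ω ι κ τ : Type*} {mΩ : MeasurableSpace Ω} {μ : Measure Ω} [IsProbabilityMeasure μ]
  [Fintype ι] [Fintype κ] [Fintype τ] [DecidableEq ι] [DecidableEq κ]

lemma integral_sub_mul_transpose_le {A : Ω → Matrix ι κ ℝ} {ρ : ℝ}
    (hmeas : AEStronglyMeasurable A μ) (hbound : ∀ᵐ ω ∂μ, ‖A ω‖ ≤ ρ) :
    ∫ ω, (A ω - ∫ ω, A ω ∂μ) * (A ω - ∫ ω, A ω ∂μ)ᵀ ∂μ ≤ ∫ ω, A ω * (A ω)ᵀ ∂μ := by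
  set E := ∫ ω, A ω ∂μ
  have hA : Integrable A μ := integrable_comp_of_norm_le hmeas hbound continuous_id
  have hsq : Integrable (fun ω => A ω * (A ω)ᵀ) μ :=
    integrable_comp_of_norm_le (g := fun M => M * Mᵀ) hmeas hbound (by fun_prop)
  let cross : Matrix ι κ ℝ →L[ℝ] Matrix ι ι ℝ := LinearMap.toContinuousLinearMap <|
    mulRightLinearMap ι ℝ Eᵀ + mulLeftLinearMap ι ℝ E ∘ₗ (transposeLinearEquiv ι κ ℝ ℝ).toLinearMap
  have hcross : ∫ ω, (A ω * Eᵀ + E * (A ω)ᵀ) ∂μ = E * Eᵀ + E * Eᵀ :=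
    cross.integral_comp_comm hA
  have hcrossInt : Integrable (fun ω => A ω * Eᵀ + E * (A ω)ᵀ) μ := cross.integrable_comp hA
  have hvar : ∫ ω, (A ω - E) * (A ω - E)ᵀ ∂μ = ∫ ω, A ω * (A ω)ᵀ ∂μ - E * Eᵀ :=
    calc ∫ ω, (A ω - E) * (A ω - E)ᵀ ∂μ
        = ∫ ω, (A ω * (A ω)ᵀ - (A ω * Eᵀ + E * (A ω)ᵀ) + E * Eᵀ) ∂μ := by
          congr 1 with ω : 1
          rw [transpose_sub, Matrix.sub_mul, Matrix.mul_sub, Matrix.mul_sub]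
          abel
      _ = _ := by
          rw [integral_add (by exact hsq.sub hcrossInt) (integrable_const _),
            integral_sub hsq hcrossInt, hcross, integral_const, probReal_univ, one_smul]
          abel
  rw [hvar]
  exact sub_le_self _ (posSemidef_self_mul_conjTranspose E).nonneg

theorem measureReal_le_norm_sum_sub_integral_le [Nonempty ι] {A : τ → Ω → Matrix ι κ ℝ}
    {ρ σ θ a : ℝ} (hindep : iIndepFun A μ) (hmeas : ∀ j, Measurable (A j))
    (hbound : ∀ j, ∀ᵐ ω ∂μ, ‖A j ω‖ ≤ ρ) (hrow : ∀ j, ∫ ω, A j ω * (A j ω)ᵀ ∂μ ≤ σ • 1)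
    (hcol : ∀ j, ∫ ω, (A j ω)ᵀ * A j ω ∂μ ≤ σ • 1) (hθ : 0 ≤ θ) (ha : 0 < a)
    (hθρ : θ * (2 * ρ) ≤ a) (y : ℝ) :
    μ.real {ω | y ≤ ‖∑ j, (A j ω - ∫ ω, A j ω ∂μ)‖} ≤ (Fintype.card ι + Fintype.card κ) *
      Real.exp (Fintype.card τ * ((Real.exp a - 1 - a) / a ^ 2 * (θ ^ 2 * σ)) - θ * y) := by
  have hA j : Integrable (A j) μ :=
    integrable_comp_of_norm_le (hmeas j).aestronglyMeasurable (hbound j) continuous_id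
  have hmean j : ‖∫ ω, A j ω ∂μ‖ ≤ ρ := by
    simpa using norm_integral_le_of_norm_le_const (hbound j)
  refine measureReal_le_norm_sum_le
    (hindep.comp (fun j M => M - ∫ ω, A j ω ∂μ) fun j => (continuous_sub_right _).measurable)
    (fun j => (continuous_sub_right _).measurable.comp (hmeas j)) (fun j => ?_) (R := 2 * ρ)
    (fun j => ?_) (fun j => ?_) (fun j => ?_) hθ ha hθρ y
  · simp [integral_sub (hA j) (integrable_const _)]
  · filter_upwards [hbound j] with ω hω
    exact (norm_sub_le _ _).trans (by linarith [hmean j])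
  · exact (integral_sub_mul_transpose_le (hmeas j).aestronglyMeasurable (hbound j)).trans (hrow j)
  · have htranspose : ∫ ω, (A j ω)ᵀ ∂μ = (∫ ω, A j ω ∂μ)ᵀ :=
      (transposeLinearEquiv ι κ ℝ ℝ).toLinearMap.toContinuousLinearMap.integral_comp_comm (hA j)
    have h := integral_sub_mul_transpose_le (A := fun ω => (A j ω)ᵀ) (ρ := ρ) (μ := μ)
      (continuous_id.matrix_transpose.comp_aestronglyMeasurable (hmeas j).aestronglyMeasurable)
      ((hbound j).mono fun ω hω => by
        rwa [← conjTranspose_eq_transpose_of_trivial, l2_opNorm_conjTranspose])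
    simp only [htranspose, ← transpose_sub, transpose_transpose] at h
    exact h.trans (hcol j)

omit [DecidableEq ι] in
lemma transpose_mul_self_le_sq_smul_one {M : Matrix ι κ ℝ} {C : ℝ} (hM : ‖M‖ ≤ C) :
    Mᵀ * M ≤ C ^ 2 • 1 := by
  have h := (norm_le_iff_sum_sq_mulVec_le ((norm_nonneg _).trans hM)).mp hM
  refine le_iff.mpr (.of_dotProduct_mulVec_nonneg ?_ fun x => ?_)
  · simp [IsHermitian, transpose_mul]
  · have hx : x ⬝ᵥ ((C ^ 2 • 1 - Mᵀ * M) *ᵥ x) = C ^ 2 * ∑ k, x k ^ 2 - ∑ i, (M *ᵥ x) i ^ 2 := by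
      rw [sub_mulVec, dotProduct_sub, smul_mulVec, one_mulVec, dotProduct_smul, ← mulVec_mulVec,
        dotProduct_mulVec, vecMul_transpose]
      simp only [dotProduct, smul_eq_mul, sq]
    simpa [hx] using h x

lemma mul_transpose_self_le_sq_smul_one {M : Matrix ι κ ℝ} {C : ℝ} (hM : ‖M‖ ≤ C) :
    M * Mᵀ ≤ C ^ 2 • 1 := by
  have h := transpose_mul_self_le_sq_smul_one (M := Mᵀ) (C := C)
  rw [← conjTranspose_eq_transpose_of_trivial, l2_opNorm_conjTranspose] at h
  simpa using h hM

lemma integral_comp_le_smul_one {E : Type*} [NormedAddCommGroup E] [ProperSpace E]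
    {ξ : Ω → E} {g : E → Matrix ι ι ℝ} {ρ v : ℝ} (hmeas : AEStronglyMeasurable ξ μ)
    (hbound : ∀ᵐ ω ∂μ, ‖ξ ω‖ ≤ ρ) (hvar : ∫ ω, ‖ξ ω‖ ^ 2 ∂μ ≤ v) (hg : Continuous g)
    (hgle : ∀ x, g x ≤ ‖x‖ ^ 2 • 1) : ∫ ω, g (ξ ω) ∂μ ≤ v • 1 :=
  calc ∫ ω, g (ξ ω) ∂μ ≤ ∫ ω, ‖ξ ω‖ ^ 2 • (1 : Matrix ι ι ℝ) ∂μ :=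
        integral_mono (integrable_comp_of_norm_le hmeas hbound hg)
          (integrable_comp_of_norm_le (g := fun x => ‖x‖ ^ 2 • (1 : Matrix ι ι ℝ)) hmeas hbound
            (by fun_prop)) fun ω => hgle _
    _ = (∫ ω, ‖ξ ω‖ ^ 2 ∂μ) • 1 := integral_smul_const _ _
    _ ≤ v • 1 := by gcongr

/-- The column matrix of a Euclidean vector; it transfers bounds for operator norms of random
matrices to random vectors. -/
def columnMatrix : EuclideanSpace ℝ ι →L[ℝ] Matrix ι Unit ℝ :=
  LinearMap.toContinuousLinearMap
    { toFun x := replicateCol Unit x.ofLp, map_add' _ _ := rfl, map_smul' _ _ := rfl }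

omit [DecidableEq ι] in
lemma columnMatrix_apply (x : EuclideanSpace ℝ ι) : columnMatrix x = replicateCol Unit x.ofLp :=
  rfl

omit [DecidableEq ι] in
lemma norm_columnMatrix (x : EuclideanSpace ℝ ι) : ‖columnMatrix x‖ = ‖x‖ := by
  have hdiag : (columnMatrix x)ᴴ * columnMatrix x = diagonal fun _ => ‖x‖ ^ 2 := by
    ext i j
    simp [columnMatrix_apply, mul_apply, EuclideanSpace.real_norm_sq_eq, ← sq]
  rw [← sq_eq_sq₀ (norm_nonneg _) (norm_nonneg _), sq, ← l2_opNorm_conjTranspose_mul_self, hdiag,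
    l2_opNorm_diagonal]
  simp

omit [DecidableEq ι] [Fintype κ] [DecidableEq κ] in
theorem measureReal_le_norm_sum_sub_integral_le_exp_neg [Nonempty ι]
    {ξ : τ → Ω → EuclideanSpace ℝ ι} {ρ v s : ℝ} (hindep : iIndepFun ξ μ)
    (hmeas : ∀ j, Measurable (ξ j)) (hbound : ∀ j, ∀ᵐ ω ∂μ, ‖ξ j ω‖ ≤ ρ)
    (hvar : ∀ j, ∫ ω, ‖ξ j ω‖ ^ 2 ∂μ ≤ v) (hρ : 0 < ρ) (hs : 0 < s) :
    μ.real {ω | 2 * s * (√(Fintype.card τ * v / s) + 2 * ρ) ≤ ‖∑ j, (ξ j ω - ∫ ω, ξ j ω ∂μ)‖}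
      ≤ (Fintype.card ι + 1) * Real.exp (-s) := by
  classical
  have hv : 0 ≤ Fintype.card τ * v := by
    simpa using Finset.sum_nonneg fun j (_ : j ∈ Finset.univ) =>
      (integral_nonneg fun ω => sq_nonneg ‖ξ j ω‖).trans (hvar j)
  set d := √(Fintype.card τ * v / s)
  have hd : d ^ 2 * s = Fintype.card τ * v := by
    rw [Real.sq_sqrt (by positivity), div_mul_cancel₀ _ hs.ne']
  have hd0 : 0 ≤ d := Real.sqrt_nonneg _
  have htail := measureReal_le_norm_sum_sub_integral_le (A := fun j ω => columnMatrix (ξ j ω))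
    (θ := 1 / (d + 2 * ρ)) (a := 1)
    (hindep.comp _ fun _ => columnMatrix.continuous.measurable)
    (fun j => columnMatrix.continuous.measurable.comp (hmeas j))
    (fun j => (hbound j).mono fun ω hω => (norm_columnMatrix _).trans_le hω)
    (fun j => integral_comp_le_smul_one (g := fun x => columnMatrix x * (columnMatrix x)ᵀ)
      (hmeas j).aestronglyMeasurable (hbound j) (hvar j) (by fun_prop)
      fun x => mul_transpose_self_le_sq_smul_one (norm_columnMatrix x).le)
    (fun j => integral_comp_le_smul_one (g := fun x => (columnMatrix x)ᵀ * columnMatrix x)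
      (hmeas j).aestronglyMeasurable (hbound j) (hvar j) (by fun_prop)
      fun x => transpose_mul_self_le_sq_smul_one (norm_columnMatrix x).le)
    (by positivity) one_pos
    (by rw [one_div_mul_eq_div, div_le_one (by positivity)]; linarith)
    (2 * s * (d + 2 * ρ))
  have hsum ω : ‖∑ j, (columnMatrix (ξ j ω) - ∫ ω, columnMatrix (ξ j ω) ∂μ)‖
      = ‖∑ j, (ξ j ω - ∫ ω, ξ j ω ∂μ)‖ := by
    have hint j : Integrable (ξ j) μ :=
      integrable_comp_of_norm_le (hmeas j).aestronglyMeasurable (hbound j) continuous_id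
    simp only [columnMatrix.integral_comp_comm (hint _), ← map_sub, ← map_sum, norm_columnMatrix]
  simp only [hsum, Fintype.card_unit, Nat.cast_one] at htail
  refine htail.trans ?_
  gcongr
  have hvar_le := mul_exp_one_sub_two_div_le hs hd0 hρ hd
  have hlin : 1 / (d + 2 * ρ) * (2 * s * (d + 2 * ρ)) = 2 * s := by field_simp
  linarith

end CentredSums

lemma exp_eight_fifths_lt : Real.exp (8 / 5) < 4.96 := by
  refine lt_of_pow_lt_pow_left₀ 5 (by norm_num) ?_
  calc Real.exp (8 / 5) ^ 5 = Real.exp 1 ^ 8 := by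
        rw [← Real.exp_nat_mul, ← Real.exp_nat_mul]
        norm_num
    _ < 2.7182818286 ^ 8 := by
        gcongr
        exact Real.exp_one_lt_d9
    _ < 4.96 ^ 5 := by norm_num

section OperatorNormTail

open Matrix
open scoped Matrix.Norms.L2Operator

theorem measureReal_two_sqrt_le_norm_sum_sub_integral_le {Ω ι κ τ : Type*}
    {mΩ : MeasurableSpace Ω} {μ : Measure Ω} [IsProbabilityMeasure μ] [Fintype ι] [Fintype κ]
    [Fintype τ] [DecidableEq ι] [DecidableEq κ] [Nonempty ι] {A : τ → Ω → Matrix ι κ ℝ} {σ b : ℝ}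
    (hindep : iIndepFun A μ) (hmeas : ∀ j, Measurable (A j))
    (hbound : ∀ j, ∀ᵐ ω ∂μ, ‖A j ω‖ ≤ 1) (hrow : ∀ j, ∫ ω, A j ω * (A j ω)ᵀ ∂μ ≤ σ • 1)
    (hcol : ∀ j, ∫ ω, (A j ω)ᵀ * A j ω ∂μ ≤ σ • 1) (hb : 0 < b) (hbσ : b ≤ Fintype.card τ * σ) :
    μ.real {ω | 2 * √(Fintype.card τ * σ * b) ≤ ‖∑ j, (A j ω - ∫ ω, A j ω ∂μ)‖}
      ≤ (Fintype.card ι + Fintype.card κ) * Real.exp (-(1.01 * b)) := by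
  set N := Fintype.card τ * σ
  have hN : 0 < N := hb.trans_le hbσ
  set q := √(b / N)
  have hq : q ^ 2 * N = b := by rw [Real.sq_sqrt (by positivity), div_mul_cancel₀ _ hN.ne']
  have hroot : √(N * b) = q * N := by
    rw [← hq, mul_left_comm, ← sq, Real.sqrt_mul (sq_nonneg q), Real.sqrt_sq (Real.sqrt_nonneg _),
      Real.sqrt_sq hN.le]
  have hq1 : q ≤ 1 := Real.sqrt_le_one.mpr ((div_le_one hN).mpr hbσ)
  refine (measureReal_le_norm_sum_sub_integral_le (θ := 4 / 5 * q) (a := 8 / 5) hindep hmeas hbound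
    hrow hcol (by positivity) (by norm_num) (by linarith) _).trans ?_
  gcongr
  calc Fintype.card τ * ((Real.exp (8 / 5) - 1 - 8 / 5) / (8 / 5) ^ 2 * ((4 / 5 * q) ^ 2 * σ))
        - 4 / 5 * q * (2 * √(N * b))
      = ((Real.exp (8 / 5) - 1 - 8 / 5) / 4 - 8 / 5) * b := by
        rw [hroot, ← hq]
        simp only [N]
        ring
    _ ≤ -1.01 * b := by
        gcongr
        linarith [exp_eight_fifths_lt]
    _ = -(1.01 * b) := by ring

end OperatorNormTail

section Fibres

variable {Ω α E : Type*} {mΩ : MeasurableSpace Ω} {μ : Measure Ω} [NormedAddCommGroup E]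
  [NormedSpace ℝ E] [CompleteSpace E] [Fintype α] [MeasurableSpace α] [MeasurableSingletonClass α]

theorem integral_smul_comp_eq_sum {T : Ω → α} (hT : Measurable T) {Z : Ω → ℝ}
    (hZ : Integrable Z μ) (f : α → E) :
    ∫ ω, Z ω • f (T ω) ∂μ = ∑ a, (∫ ω in T ⁻¹' {a}, Z ω ∂μ) • f a := by
  have hfibre a : Set.EqOn (fun ω => Z ω • f (T ω)) (fun ω => Z ω • f a) (T ⁻¹' {a}) :=
    fun ω hω => congrArg (fun b => Z ω • f b) hω
  have hmeas a : MeasurableSet (T ⁻¹' {a}) := hT (measurableSet_singleton a)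
  calc ∫ ω, Z ω • f (T ω) ∂μ
      = ∫ ω in ⋃ a, T ⁻¹' {a}, Z ω • f (T ω) ∂μ := by
        rw [← Set.preimage_iUnion, Set.iUnion_of_singleton, Set.preimage_univ, setIntegral_univ]
    _ = ∑ a, ∫ ω in T ⁻¹' {a}, Z ω • f (T ω) ∂μ :=
        integral_iUnion_fintype hmeas (pairwise_disjoint_fiber T) fun a =>
          ((hZ.smul_const (f a)).integrableOn).congr_fun (hfibre a).symm (hmeas a)
    _ = ∑ a, (∫ ω in T ⁻¹' {a}, Z ω ∂μ) • f a :=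
        Finset.sum_congr rfl fun a _ => by
          rw [setIntegral_congr_fun (hmeas a) (hfibre a), integral_smul_const]

end Fibres

namespace IsSample

variable {V : Type*} [Fintype V] [MeasurableSpace V] {Ω : Type*} [MeasurableSpace Ω]
  {μ : Measure Ω} {n : ℕ} {Sstar : Matrix V V ℝ} {X X' : Fin n → Ω → V} {Y : Fin n → Ω → ℝ}

omit [Fintype V] in
lemma abs_label (h : IsSample μ Sstar X X' Y) (j : Fin n) (ω : Ω) : |Y j ω| = 1 := by
  rcases h.label j ω with hω | hω <;> rw [hω] <;> norm_num

omit [Fintype V] in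
lemma integrable_label [IsFiniteMeasure μ] (h : IsSample μ Sstar X X' Y) (j : Fin n) :
    Integrable (Y j) μ :=
  .of_bound (h.measurable_label j).aestronglyMeasurable 1
    (ae_of_all _ fun ω => (h.abs_label j ω).le)

variable [MeasurableSingletonClass V]

lemma measureReal_pair (h : IsSample μ Sstar X X' Y) (j : Fin n) (u v : V) :
    μ.real (X j ⁻¹' {u} ∩ X' j ⁻¹' {v}) = ((Fintype.card V : ℝ) ^ 2)⁻¹ := by
  have hunif {Z : Ω → V} (hZ : HasLaw Z (uniformOn Set.univ) μ) (u : V) :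
      μ.real (Z ⁻¹' {u}) = (Fintype.card V : ℝ)⁻¹ := by
    rw [← map_measureReal_apply_of_aemeasurable hZ.aemeasurable (measurableSet_singleton u),
      hZ.map_eq, measureReal_def, uniformOn_univ, Measure.count_singleton, one_div,
      ENNReal.toReal_inv, ENNReal.toReal_natCast]
  rw [measureReal_def, (h.indep_pair j).measure_inter_preimage_eq_mul {u} {v}
    (measurableSet_singleton u) (measurableSet_singleton v), ENNReal.toReal_mul, ← measureReal_def,
    ← measureReal_def, hunif (h.law_fst j), hunif (h.law_snd j), ← mul_inv, sq]

lemma setIntegral_label (h : IsSample μ Sstar X X' Y) (j : Fin n) (u v : V) :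
    ∫ ω in X j ⁻¹' {u} ∩ X' j ⁻¹' {v}, Y j ω ∂μ = ((Fintype.card V : ℝ) ^ 2)⁻¹ * Sstar u v := by
  have hpair := h.measureReal_pair j u v
  have := Fintype.card_pos_iff.mpr ⟨u⟩
  have hpos : μ.real (X j ⁻¹' {u} ∩ X' j ⁻¹' {v}) ≠ 0 := by
    rw [hpair]
    positivity
  rw [← h.regression j u v, ProbabilityTheory.cond, integral_smul_measure, ENNReal.toReal_inv,
    ← measureReal_def, smul_eq_mul, ← hpair, mul_inv_cancel_left₀ hpos]

variable [IsProbabilityMeasure μ] {E : Type*} [NormedAddCommGroup E] [NormedSpace ℝ E]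
  [CompleteSpace E]

lemma integral_comp_pair (h : IsSample μ Sstar X X' Y) (j : Fin n) (f : V → V → E) :
    ∫ ω, f (X j ω) (X' j ω) ∂μ = ((Fintype.card V : ℝ) ^ 2)⁻¹ • ∑ u, ∑ v, f u v := by
  have hfibres := integral_smul_comp_eq_sum ((h.measurable_fst j).prodMk (h.measurable_snd j))
    (integrable_const (μ := μ) (1 : ℝ)) fun p => f p.1 p.2
  simp only [one_smul, ← Set.singleton_prod_singleton, Set.mk_preimage_prod, setIntegral_const,
    smul_eq_mul, mul_one, h.measureReal_pair, Fintype.sum_prod_type, ← Finset.smul_sum] at hfibres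
  exact hfibres

lemma integral_label_smul (h : IsSample μ Sstar X X' Y) (j : Fin n) (f : V → V → E) :
    ∫ ω, Y j ω • f (X j ω) (X' j ω) ∂μ
      = ((Fintype.card V : ℝ) ^ 2)⁻¹ • ∑ u, ∑ v, Sstar u v • f u v := by
  have hfibres := integral_smul_comp_eq_sum ((h.measurable_fst j).prodMk (h.measurable_snd j))
    (h.integrable_label j) fun p => f p.1 p.2
  simp only [← Set.singleton_prod_singleton, Set.mk_preimage_prod, h.setIntegral_label,
    Fintype.sum_prod_type, mul_smul, ← Finset.smul_sum] at hfibres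
  exact hfibres

end IsSample

lemma sq_two_mul_sqrt_div_add_le {a s : ℝ} (ha : 0 ≤ a) (hs : 0 < s) (ρ : ℝ) :
    (2 * s * (√(a / s) + 2 * ρ)) ^ 2 ≤ 8 * a * s + 32 * ρ ^ 2 * s ^ 2 :=
  calc (2 * s * (√(a / s) + 2 * ρ)) ^ 2
      ≤ 8 * s ^ 2 * √(a / s) ^ 2 + 32 * ρ ^ 2 * s ^ 2 := by
        nlinarith [sq_nonneg (s * (√(a / s) - 2 * ρ))]
    _ = 8 * a * s + 32 * ρ ^ 2 * s ^ 2 := by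
        rw [Real.sq_sqrt (by positivity)]
        field

section Noise

open Matrix
open scoped Matrix.Norms.L2Operator

variable {V ι κ : Type*} [Fintype V] [DecidableEq V] [Fintype ι] [Fintype κ]

/-- The squared Frobenius norm. -/
def frobSq (M : Matrix ι κ ℝ) : ℝ := ∑ i, ∑ j, M i j ^ 2

/-- The noise of the sample: the centred empirical matrix `∑ⱼ yⱼ (e_{xⱼ} ⊗ e_{x'ⱼ}) - (n / m²) S`,
without the usual factor `1 / n`. -/
def noise {n : ℕ} (S : Matrix V V ℝ) (x x' : Fin n → V) (y : Fin n → ℝ) : Matrix V V ℝ :=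
  ∑ j, single (x j) (x' j) (y j) - (n / (Fintype.card V : ℝ) ^ 2) • S

lemma norm_single_le (u v : V) (y : ℝ) : ‖single u v y‖ ≤ |y| := by
  rw [norm_le_iff_sum_sq_mulVec_le (abs_nonneg y)]
  intro x
  calc ∑ i, (single u v y *ᵥ x) i ^ 2 = |y| ^ 2 * x v ^ 2 := by
        simp [single_mulVec, ← Pi.single.eq_1, Pi.single_apply, ite_pow, mul_pow]
    _ ≤ |y| ^ 2 * ∑ k, x k ^ 2 := by
        gcongr
        exact Finset.single_le_sum (fun k _ => sq_nonneg (x k)) (Finset.mem_univ v)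

omit [Fintype ι] [Fintype κ] in
lemma mul_single_mul_apply (B : Matrix ι V ℝ) (C : Matrix V κ ℝ) (u v : V) (y : ℝ) (i : ι)
    (k : κ) : (B * single u v y * C) i k = B i u * y * C v k := by
  simp [mul_assoc, mul_apply, single_apply, ite_and]

lemma frobSq_mul_single_mul (B : Matrix ι V ℝ) (C : Matrix V κ ℝ) (u v : V) (y : ℝ) :
    frobSq (B * single u v y * C) = y ^ 2 * ((∑ i, B i u ^ 2) * ∑ k, C v k ^ 2) := by
  rw [Finset.sum_mul_sum]
  simp only [frobSq, mul_single_mul_apply, Finset.mul_sum]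
  exact Finset.sum_congr rfl fun i _ => Finset.sum_congr rfl fun k _ => by ring

lemma frobSq_nonneg (M : Matrix ι κ ℝ) : 0 ≤ frobSq M :=
  Finset.sum_nonneg fun _ _ => Finset.sum_nonneg fun _ _ => sq_nonneg _

lemma frobSq_transpose (M : Matrix ι κ ℝ) : frobSq Mᵀ = frobSq M := Finset.sum_comm

lemma norm_sq_toLp_vec (M : Matrix ι κ ℝ) : ‖WithLp.toLp 2 (vec M)‖ ^ 2 = frobSq M := by
  rw [EuclideanSpace.real_norm_sq_eq, Fintype.sum_prod_type, ← frobSq_transpose]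
  rfl

/-- The linear map `M ↦ B M C`, with the entries of the result listed as a Euclidean vector. -/
def sandwichVec (B : Matrix ι V ℝ) (C : Matrix V κ ℝ) :
    Matrix V V ℝ →L[ℝ] EuclideanSpace ℝ (κ × ι) :=
  LinearMap.toContinuousLinearMap
    { toFun M := WithLp.toLp 2 (vec (B * M * C))
      map_add' M N := by rw [Matrix.mul_add, Matrix.add_mul, vec_add, WithLp.toLp_add]
      map_smul' a M := by
        rw [Matrix.mul_smul, Matrix.smul_mul, vec_smul, WithLp.toLp_smul, RingHom.id_apply] }

omit [DecidableEq V] in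
lemma norm_sq_sandwichVec (B : Matrix ι V ℝ) (C : Matrix V κ ℝ) (M : Matrix V V ℝ) :
    ‖sandwichVec B C M‖ ^ 2 = frobSq (B * M * C) := norm_sq_toLp_vec _

lemma measurable_single [MeasurableSpace V] [MeasurableSingletonClass V] :
    Measurable fun p : V × V × ℝ => single p.1 p.2.1 p.2.2 := by
  refine measurable_from_prod_countable_right fun u =>
    measurable_from_prod_countable_right fun v => ?_
  exact (singleLinearMap ℝ (α := ℝ) u v).continuous_of_finiteDimensional.measurable

namespace IsSample

variable [MeasurableSpace V] [MeasurableSingletonClass V] {Ω : Type*} [MeasurableSpace Ω]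
  {μ : Measure Ω} {n : ℕ} {Sstar : Matrix V V ℝ} {X X' : Fin n → Ω → V} {Y : Fin n → Ω → ℝ}

lemma measurable_single (h : IsSample μ Sstar X X' Y) (j : Fin n) :
    Measurable fun ω => single (X j ω) (X' j ω) (Y j ω) :=
  SimilarityKernel.measurable_single.comp
    ((h.measurable_fst j).prodMk ((h.measurable_snd j).prodMk (h.measurable_label j)))

omit [MeasurableSingletonClass V] in
lemma norm_single_le (h : IsSample μ Sstar X X' Y) (j : Fin n) (ω : Ω) :
    ‖single (X j ω) (X' j ω) (Y j ω)‖ ≤ 1 :=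
  (SimilarityKernel.norm_single_le _ _ _).trans_eq (h.abs_label j ω)

lemma iIndepFun_single (h : IsSample μ Sstar X X' Y) :
    iIndepFun (fun j ω => single (X j ω) (X' j ω) (Y j ω)) μ :=
  h.indep.comp _ fun _ => SimilarityKernel.measurable_single

omit [MeasurableSingletonClass V] in
lemma norm_sq_sandwichVec_single (h : IsSample μ Sstar X X' Y) (B : Matrix ι V ℝ)
    (C : Matrix V κ ℝ) (j : Fin n) (ω : Ω) :
    ‖sandwichVec B C (single (X j ω) (X' j ω) (Y j ω))‖ ^ 2
      = (∑ i, B i (X j ω) ^ 2) * ∑ k, C (X' j ω) k ^ 2 := by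
  rw [norm_sq_sandwichVec, frobSq_mul_single_mul, ← sq_abs (Y j ω), h.abs_label, one_pow, one_mul]

variable [IsProbabilityMeasure μ]

lemma integral_single (h : IsSample μ Sstar X X' Y) (j : Fin n) :
    ∫ ω, single (X j ω) (X' j ω) (Y j ω) ∂μ = ((Fintype.card V : ℝ) ^ 2)⁻¹ • Sstar := by
  conv_rhs => rw [matrix_eq_sum_single Sstar]
  simpa [smul_single] using h.integral_label_smul j fun u v => single u v (1 : ℝ)

lemma integral_single_mul_transpose (h : IsSample μ Sstar X X' Y) (j : Fin n) :
    ∫ ω, single (X j ω) (X' j ω) (Y j ω) * (single (X j ω) (X' j ω) (Y j ω))ᵀ ∂μ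
      = (Fintype.card V : ℝ)⁻¹ • 1 := by
  have hY ω : Y j ω * Y j ω = 1 := by rw [← abs_mul_abs_self, h.abs_label, one_mul]
  simp only [transpose_single, single_mul_single_same, hY]
  rw [h.integral_comp_pair j fun u _ => single u u (1 : ℝ), ← sum_single_one]
  simp only [Finset.sum_const, Finset.card_univ, ← Finset.smul_sum, ← Nat.cast_smul_eq_nsmul ℝ,
    smul_smul]
  congr 1
  field

lemma integral_transpose_mul_single (h : IsSample μ Sstar X X' Y) (j : Fin n) :
    ∫ ω, (single (X j ω) (X' j ω) (Y j ω))ᵀ * single (X j ω) (X' j ω) (Y j ω) ∂μ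
      = (Fintype.card V : ℝ)⁻¹ • 1 := by
  have hY ω : Y j ω * Y j ω = 1 := by rw [← abs_mul_abs_self, h.abs_label, one_mul]
  simp only [transpose_single, single_mul_single_same, hY]
  rw [h.integral_comp_pair j fun _ v => single v v (1 : ℝ), ← sum_single_one]
  simp only [Finset.sum_const, Finset.card_univ, ← Nat.cast_smul_eq_nsmul ℝ, smul_smul]
  congr 1
  field

lemma noise_eq_sum_sub_integral (h : IsSample μ Sstar X X' Y) (ω : Ω) :
    noise Sstar (X · ω) (X' · ω) (Y · ω)
      = ∑ j, (single (X j ω) (X' j ω) (Y j ω)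
          - ∫ ω', single (X j ω') (X' j ω') (Y j ω') ∂μ) := by
  simp only [noise, h.integral_single, Finset.sum_sub_distrib, Finset.sum_const, Finset.card_univ,
    Fintype.card_fin, ← Nat.cast_smul_eq_nsmul ℝ, smul_smul, div_eq_mul_inv]

theorem measureReal_le_norm_noise_le [Nonempty V] (h : IsSample μ Sstar X X' Y) {b : ℝ}
    (hb : 0 < b) (hbn : b ≤ n * (Fintype.card V : ℝ)⁻¹) :
    μ.real {ω | 2 * √(n * (Fintype.card V : ℝ)⁻¹ * b)
        ≤ ‖noise Sstar (X · ω) (X' · ω) (Y · ω)‖}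
      ≤ 2 * Fintype.card V * Real.exp (-(1.01 * b)) := by
  have htail := measureReal_two_sqrt_le_norm_sum_sub_integral_le h.iIndepFun_single
    h.measurable_single (fun j => ae_of_all _ (h.norm_single_le j))
    (fun j => (h.integral_single_mul_transpose j).le)
    (fun j => (h.integral_transpose_mul_single j).le) hb (by simpa using hbn)
  simpa only [h.noise_eq_sum_sub_integral, Fintype.card_fin, two_mul] using htail

lemma integral_norm_sq_sandwichVec_single (h : IsSample μ Sstar X X' Y) (B : Matrix ι V ℝ)
    (C : Matrix V κ ℝ) (j : Fin n) :
    ∫ ω, ‖sandwichVec B C (single (X j ω) (X' j ω) (Y j ω))‖ ^ 2 ∂μ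
      = frobSq B * frobSq C / (Fintype.card V : ℝ) ^ 2 := by
  simp only [h.norm_sq_sandwichVec_single]
  rw [h.integral_comp_pair j fun u v => (∑ i, B i u ^ 2) * ∑ k, C v k ^ 2, ← Finset.sum_mul_sum,
    smul_eq_mul, ← div_eq_inv_mul, ← frobSq_transpose B]
  rfl

lemma sandwichVec_noise (h : IsSample μ Sstar X X' Y) (B : Matrix ι V ℝ) (C : Matrix V κ ℝ)
    (ω : Ω) : sandwichVec B C (noise Sstar (X · ω) (X' · ω) (Y · ω))
      = ∑ j, (sandwichVec B C (single (X j ω) (X' j ω) (Y j ω))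
          - ∫ ω', sandwichVec B C (single (X j ω') (X' j ω') (Y j ω')) ∂μ) := by
  have hint j : Integrable (fun ω => single (X j ω) (X' j ω) (Y j ω)) μ :=
    integrable_comp_of_norm_le (h.measurable_single j).aestronglyMeasurable
      (ae_of_all _ (h.norm_single_le j)) continuous_id
  simp only [h.noise_eq_sum_sub_integral, map_sum, map_sub,
    (sandwichVec B C).integral_comp_comm (hint _)]

theorem measureReal_lt_frobSq_mul_noise_mul_le [Nonempty ι] [Nonempty κ]
    (h : IsSample μ Sstar X X' Y) (B : Matrix ι V ℝ) (C : Matrix V κ ℝ) {ρ s : ℝ} (hρ : 0 < ρ)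
    (hs : 0 < s) (hbound : ∀ u v, (∑ i, B i u ^ 2) * ∑ k, C v k ^ 2 ≤ ρ ^ 2) :
    μ.real {ω | 8 * n * (frobSq B * frobSq C / (Fintype.card V : ℝ) ^ 2) * s + 32 * ρ ^ 2 * s ^ 2
        < frobSq (B * noise Sstar (X · ω) (X' · ω) (Y · ω) * C)}
      ≤ (Fintype.card κ * Fintype.card ι + 1) * Real.exp (-s) := by
  have hξ : Measurable (sandwichVec B C) := (sandwichVec B C).continuous.measurable
  have htail := measureReal_le_norm_sum_sub_integral_le_exp_neg
    (h.iIndepFun_single.comp _ fun _ => hξ) (fun j => hξ.comp (h.measurable_single j))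
    (fun j => ae_of_all _ fun ω => le_of_sq_le_sq
      ((h.norm_sq_sandwichVec_single B C j ω).trans_le (hbound _ _)) hρ.le)
    (fun j => (h.integral_norm_sq_sandwichVec_single B C j).le) hρ hs
  rw [Fintype.card_prod, Nat.cast_mul, Fintype.card_fin] at htail
  refine (measureReal_mono fun ω hω => ?_).trans htail
  refine le_of_sq_le_sq ?_ (norm_nonneg _)
  refine (sq_two_mul_sqrt_div_add_le ?_ hs ρ).trans ?_
  · have := frobSq_nonneg B
    have := frobSq_nonneg C
    positivity
  · simp only [Function.comp_apply, ← h.sandwichVec_noise, norm_sq_sandwichVec]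
    rw [← mul_assoc]
    exact hω.le

end IsSample

end Noise

section NuclearNorm

open Matrix
open scoped Matrix.Norms.L2Operator

variable {V : Type*} [Fintype V] [DecidableEq V]

lemma cfc_mul_eq (S : Matrix V V ℝ) (f g : ℝ → ℝ) :
    cfc (fun x => f x * g x) S = cfc f S * cfc g S :=
  cfc_mul f g S (finite_real_spectrum.continuousOn f) (finite_real_spectrum.continuousOn g)

/-- The sign `sgn S` of a symmetric kernel, with `sgn 0 = 0`: the dual certificate of the nuclear
norm at `S`. -/
def signMatrix (S : Matrix V V ℝ) : Matrix V V ℝ := cfc Real.sign S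

/-- The matrix of the orthogonal projection onto `supp S`, encoded as `(sgn S)²`. -/
def suppProj (S : Matrix V V ℝ) : Matrix V V ℝ := signMatrix S * signMatrix S

lemma isSelfAdjoint_signMatrix (S : Matrix V V ℝ) : IsSelfAdjoint (signMatrix S) :=
  cfc_predicate _ S

lemma isSymm_signMatrix (S : Matrix V V ℝ) : (signMatrix S).IsSymm :=
  isSelfAdjoint_iff_isSymm.mp (isSelfAdjoint_signMatrix S)

lemma isSymm_suppProj (S : Matrix V V ℝ) : (suppProj S).IsSymm := by
  rw [IsSymm, suppProj, transpose_mul, isSymm_signMatrix]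

lemma suppProj_eq_cfc (S : Matrix V V ℝ) :
    suppProj S = cfc (fun x => Real.sign x * Real.sign x) S := (cfc_mul_eq S _ _).symm

lemma suppProj_mul_signMatrix (S : Matrix V V ℝ) : suppProj S * signMatrix S = signMatrix S := by
  rw [suppProj_eq_cfc, signMatrix, ← cfc_mul_eq]
  congr 1
  ext x
  rcases Real.sign_apply_eq x with h | h | h <;> rw [h] <;> norm_num

lemma signMatrix_mul_suppProj (S : Matrix V V ℝ) : signMatrix S * suppProj S = signMatrix S := by
  rw [suppProj, ← mul_assoc, ← suppProj, suppProj_mul_signMatrix]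

lemma suppProj_mul_self (S : Matrix V V ℝ) : suppProj S * suppProj S = suppProj S := by
  nth_rw 2 [suppProj]
  rw [← mul_assoc, suppProj_mul_signMatrix, suppProj]

lemma isStarProjection_suppProj (S : Matrix V V ℝ) : IsStarProjection (suppProj S) :=
  ⟨suppProj_mul_self S, isSelfAdjoint_iff_isSymm.mpr (isSymm_suppProj S)⟩

lemma suppProj_eq_mul_cfc_inv {S : Matrix V V ℝ} (hS : S.IsSymm) :
    suppProj S = S * cfc (fun x : ℝ => x⁻¹) S := by
  have hS' := isSelfAdjoint_iff_isSymm.mpr hS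
  nth_rw 2 [← cfc_id' ℝ S]
  rw [suppProj_eq_cfc, ← cfc_mul_eq]
  congr 1
  ext x
  rcases lt_trichotomy x 0 with h | rfl | h
  · rw [Real.sign_of_neg h, mul_inv_cancel₀ h.ne, neg_mul_neg, one_mul]
  · rw [Real.sign_zero, zero_mul, zero_mul]
  · rw [Real.sign_of_pos h, mul_inv_cancel₀ h.ne', one_mul]

lemma suppProj_mul {S : Matrix V V ℝ} (hS : S.IsSymm) : suppProj S * S = S := by
  have hS' := isSelfAdjoint_iff_isSymm.mpr hS
  calc suppProj S * S = cfc (fun x => Real.sign x * Real.sign x * x) S := by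
        rw [cfc_mul_eq, ← suppProj_eq_cfc, cfc_id' ℝ S]
    _ = cfc (fun x => x) S := by
        congr 1
        ext x
        rcases lt_trichotomy x 0 with h | rfl | h
        · rw [Real.sign_of_neg h]; ring
        · rw [mul_zero]
        · rw [Real.sign_of_pos h]; ring
    _ = S := cfc_id' ℝ S

lemma trace_signMatrix_mul {S : Matrix V V ℝ} (hS : S.IsSymm) :
    (signMatrix S * S).trace = nuclearNorm S := by
  have hS' := isSelfAdjoint_iff_isSymm.mpr hS
  rw [nuclearNorm, CFC.abs_eq_cfc_norm S hS']
  nth_rw 2 [← cfc_id' ℝ S]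
  rw [signMatrix, ← cfc_mul_eq]
  congr 2
  ext x
  rcases lt_trichotomy x 0 with h | rfl | h
  · rw [Real.sign_of_neg h, Real.norm_of_nonpos h.le, neg_one_mul]
  · rw [mul_zero, norm_zero]
  · rw [Real.sign_of_pos h, Real.norm_of_nonneg h.le, one_mul]

lemma trace_suppProj {S : Matrix V V ℝ} (hS : S.IsSymm) : (suppProj S).trace = S.rank := by
  have hS' : S.IsHermitian := isSelfAdjoint_iff_isSymm.mpr hS
  have hsign x : Real.sign x * Real.sign x = if x ≠ 0 then 1 else 0 := by
    split_ifs with hx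
    · rcases Real.sign_apply_eq_of_ne_zero x hx with h | h <;> rw [h] <;> norm_num
    · rw [not_not.mp hx, Real.sign_zero, mul_zero]
  rw [suppProj_eq_cfc, trace_cfc hS', hS'.rank_eq_card_non_zero_eigs, Fintype.card_subtype]
  simp only [hsign, Finset.sum_boole]

lemma le_smul_one_of_mul_self_le {M : Matrix V V ℝ} (hM : IsSelfAdjoint M) {y : ℝ} (hy : 0 < y)
    (h : M * M ≤ y ^ 2 • 1) : M ≤ y • 1 := by
  have hsq : 0 ≤ (y • 1 - M) * (y • 1 - M) :=
    (((IsSelfAdjoint.all y).smul (IsSelfAdjoint.one _)).sub hM).mul_self_nonneg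
  have hsum : 0 ≤ (2 * y)⁻¹ • ((y • 1 - M) * (y • 1 - M) + (y ^ 2 • 1 - M * M)) :=
    smul_nonneg (by positivity) (add_nonneg hsq (sub_nonneg.mpr h))
  rw [← sub_nonneg]
  convert hsum using 1
  rw [eq_inv_smul_iff₀ (by positivity)]
  simp only [sub_mul, mul_sub, smul_mul_assoc, mul_smul_comm, one_mul, mul_one, sq]
  module

lemma trace_mul_le_of_mul_self_le {M S : Matrix V V ℝ} (hM : IsSelfAdjoint M) (hS : S.IsSymm)
    {y : ℝ} (hy : 0 < y) (h : M * M ≤ y ^ 2 • 1) : (M * S).trace ≤ y * nuclearNorm S := by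
  have hS' := isSelfAdjoint_iff_isSymm.mpr hS
  have hpos := trace_mul_le_trace_mul (CFC.posPart_nonneg S) (le_smul_one_of_mul_self_le hM hy h)
  have hneg := trace_mul_le_trace_mul (CFC.negPart_nonneg S)
    (le_smul_one_of_mul_self_le hM.neg hy (by rwa [neg_mul_neg]))
  rw [trace_mul_comm] at hpos hneg
  simp only [neg_mul, trace_neg, Matrix.mul_smul, mul_one, trace_smul, smul_eq_mul] at hpos hneg
  calc (M * S).trace = (M * S⁺).trace - (M * S⁻).trace := by
        rw [← trace_sub, ← mul_sub, CFC.posPart_sub_negPart S]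
    _ ≤ y * (S⁺).trace + y * (S⁻).trace := by linarith
    _ = y * nuclearNorm S := by
        rw [← mul_add, ← trace_add, CFC.posPart_add_negPart S, nuclearNorm]

theorem trace_transpose_mul_le_norm_mul_nuclearNorm {M S : Matrix V V ℝ} (hS : S.IsSymm) {y : ℝ}
    (hy : 0 < y) (hM : ‖M‖ ≤ y) : (Mᵀ * S).trace ≤ y * nuclearNorm S := by
  have hsymm : ((1 / 2 : ℝ) • (M + Mᵀ)).IsSymm := by
    rw [IsSymm, transpose_smul, transpose_add, transpose_transpose, add_comm]
  have hnorm : ‖(1 / 2 : ℝ) • (M + Mᵀ)‖ ≤ y := by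
    have := norm_add_le M Mᵀ
    rw [← conjTranspose_eq_transpose_of_trivial, l2_opNorm_conjTranspose] at this
    rw [norm_smul, Real.norm_of_nonneg (by norm_num), ← conjTranspose_eq_transpose_of_trivial]
    linarith
  have hsq := transpose_mul_self_le_sq_smul_one hnorm
  rw [hsymm] at hsq
  have htrace : (M * S).trace = (Mᵀ * S).trace := by
    rw [← trace_transpose, transpose_mul, hS, trace_mul_comm]
  calc (Mᵀ * S).trace = ((1 / 2 : ℝ) • (M + Mᵀ) * S).trace := by
        rw [smul_mul, trace_smul, add_mul, trace_add, htrace, smul_eq_mul]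
        ring
    _ ≤ y * nuclearNorm S := trace_mul_le_of_mul_self_le (isSelfAdjoint_iff_isSymm.mpr hsymm) hS hy
        hsq

theorem nuclearNorm_smul_add_smul_le {S T : Matrix V V ℝ} (hS : S.IsSymm) (hT : T.IsSymm) {a b : ℝ}
    (ha : 0 ≤ a) (hb : 0 ≤ b) :
    nuclearNorm (a • S + b • T) ≤ a * nuclearNorm S + b * nuclearNorm T := by
  set G := signMatrix (a • S + b • T)
  have hG : G * G ≤ (1 : ℝ) ^ 2 • 1 := by
    rw [one_pow, one_smul]
    exact (isStarProjection_suppProj _).le_one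
  have hGs := isSelfAdjoint_signMatrix (a • S + b • T)
  rw [← trace_signMatrix_mul ((hS.smul a).add (hT.smul b)), mul_add, trace_add, Matrix.mul_smul,
    Matrix.mul_smul, trace_smul, trace_smul, smul_eq_mul, smul_eq_mul,
    ← one_mul (nuclearNorm S), ← one_mul (nuclearNorm T)]
  gcongr
  · exact trace_mul_le_of_mul_self_le hGs hS one_pos hG
  · exact trace_mul_le_of_mul_self_le hGs hT one_pos hG

lemma signMatrix_mul_signMatrix_eq_zero {S N : Matrix V V ℝ} (hN : N.IsSymm)
    (h : suppProj S * N = 0) : signMatrix S * signMatrix N = 0 := by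
  rw [← signMatrix_mul_suppProj S, ← suppProj_mul_signMatrix N, suppProj_eq_mul_cfc_inv hN]
  simp only [mul_assoc]
  rw [← mul_assoc _ N, h, zero_mul, mul_zero]

lemma isStarProjection_sq_signMatrix_add {S N : Matrix V V ℝ} (hN : N.IsSymm)
    (h : suppProj S * N = 0) :
    IsStarProjection ((signMatrix S + signMatrix N) * (signMatrix S + signMatrix N)) := by
  have hSN := signMatrix_mul_signMatrix_eq_zero hN h
  have hNS : signMatrix N * signMatrix S = 0 := by
    rw [← transpose_inj, transpose_mul, isSymm_signMatrix, isSymm_signMatrix, hSN, transpose_zero]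
  have hsum : (signMatrix S + signMatrix N) * (signMatrix S + signMatrix N)
      = suppProj S + suppProj N := by
    rw [add_mul, mul_add, mul_add, hSN, hNS, add_zero, zero_add, suppProj, suppProj]
  rw [hsum]
  refine (isStarProjection_suppProj S).add (isStarProjection_suppProj N) ?_
  rw [suppProj, suppProj, mul_assoc, ← mul_assoc _ (signMatrix N), hSN, zero_mul, mul_zero]

theorem nuclearNorm_add_trace_add_nuclearNorm_le {S T : Matrix V V ℝ} (hS : S.IsSymm)
    (hT : T.IsSymm) :
    nuclearNorm S + (signMatrix S * (T - S)).trace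
        + nuclearNorm ((1 - suppProj S) * (T - S) * (1 - suppProj S))
      ≤ nuclearNorm T := by
  set Q := 1 - suppProj S
  set N := Q * (T - S) * Q
  have hQ : Qᵀ = Q := by rw [transpose_sub, transpose_one, isSymm_suppProj]
  have hN : N.IsSymm := by
    rw [IsSymm, transpose_mul, transpose_mul, hQ, (hT.sub hS).eq, ← mul_assoc]
  have hPN : suppProj S * N = 0 := by
    simp only [N, ← mul_assoc]
    rw [(isStarProjection_suppProj S).mul_one_sub_self, zero_mul, zero_mul]
  have hNP : signMatrix N * suppProj S = 0 := by
    rw [← transpose_inj, transpose_mul, isSymm_signMatrix, isSymm_suppProj, transpose_zero,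
      suppProj, mul_assoc, signMatrix_mul_signMatrix_eq_zero hN hPN, mul_zero]
  have hNQ : signMatrix N * Q = signMatrix N := by rw [mul_sub, hNP, mul_one, sub_zero]
  have hQN : Q * signMatrix N = signMatrix N := by
    rw [← transpose_inj, transpose_mul, isSymm_signMatrix, hQ, hNQ]
  have htrace : (signMatrix N * T).trace = nuclearNorm N := by
    have hNS : signMatrix N * S = 0 := by rw [← suppProj_mul hS, ← mul_assoc, hNP, zero_mul]
    rw [← trace_signMatrix_mul hN, ← mul_assoc, ← mul_assoc, hNQ, trace_mul_comm _ Q, ← mul_assoc,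
      hQN, mul_sub, hNS, sub_zero]
  have hdual := trace_mul_le_of_mul_self_le
    ((isSelfAdjoint_signMatrix S).add (isSelfAdjoint_signMatrix N)) hT one_pos
    (by simpa using (isStarProjection_sq_signMatrix_add hN hPN).le_one)
  rw [add_mul, trace_add, htrace, one_mul] at hdual
  rw [mul_sub, trace_sub, trace_signMatrix_mul hS]
  linarith

lemma toEuclideanLin_mem_supp {S : Matrix V V ℝ} (hS : S.IsSymm) (x : EuclideanSpace ℝ V) :
    toEuclideanLin S x ∈ supp S := by
  have hS' : S.IsHermitian := isSelfAdjoint_iff_isSymm.mpr hS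
  rw [← hS'.eigenvectorBasis.sum_repr x, map_sum]
  refine Submodule.sum_mem _ fun i _ => ?_
  have heig : toEuclideanLin S (hS'.eigenvectorBasis i)
      = hS'.eigenvalues i • hS'.eigenvectorBasis i := by
    ext1
    exact congrFun (hS'.mulVec_eigenvectorBasis i) _
  rw [map_smul, heig]
  refine Submodule.smul_mem _ _ ?_
  by_cases h0 : hS'.eigenvalues i = 0
  · rw [h0, zero_smul]
    exact Submodule.zero_mem _
  · exact Submodule.smul_mem _ _ (Submodule.subset_span ⟨_, h0, heig⟩)

lemma toEuclideanLin_suppProj_of_mem_supp {S : Matrix V V ℝ} (hS : S.IsSymm)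
    {x : EuclideanSpace ℝ V} (hx : x ∈ supp S) : toEuclideanLin (suppProj S) x = x := by
  induction hx using Submodule.span_induction with
  | mem ψ hψ =>
    obtain ⟨σ, hσ, heig⟩ := hψ
    refine smul_right_injective _ hσ ?_
    simp only
    rw [← map_smul, ← heig, ← LinearMap.comp_apply, ← toLpLin_mul_same, suppProj_mul hS]
  | zero => exact map_zero _
  | add x y _ _ hx hy => rw [map_add, hx, hy]
  | smul a x _ hx => rw [map_smul, hx]

theorem starProjection_supp {S : Matrix V V ℝ} (hS : S.IsSymm) (x : EuclideanSpace ℝ V) :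
    (supp S).starProjection x = toEuclideanLin (suppProj S) x := by
  refine Submodule.eq_starProjection_of_mem_orthogonal ?_ ?_
  · rw [suppProj_eq_mul_cfc_inv hS, toLpLin_mul_same]
    exact toEuclideanLin_mem_supp hS _
  · refine (Submodule.mem_orthogonal _ _).mpr fun ψ hψ => ?_
    have hPψ : toEuclideanLin (suppProj S) ψ = ψ := toEuclideanLin_suppProj_of_mem_supp hS hψ
    have hsymm := isSymmetric_toEuclideanLin_iff.mpr (isStarProjection_suppProj S).isSelfAdjoint
    rw [inner_sub_right, ← hsymm, hPψ, sub_self]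

lemma projSq_supp {S : Matrix V V ℝ} (hS : S.IsSymm) (x : EuclideanSpace ℝ V) :
    projSq (supp S) x = ∑ v, (suppProj S *ᵥ x) v ^ 2 := by
  rw [projSq, starProjection_supp hS, EuclideanSpace.real_norm_sq_eq]
  rfl

end NuclearNorm

section PenalizedRisk

open Matrix

variable {V : Type*} [Fintype V]

lemma l2Sq_eq_frobSq_div (S : Matrix V V ℝ) : l2Sq S = frobSq S / (Fintype.card V : ℝ) ^ 2 := rfl

lemma l2Sq_nonneg (S : Matrix V V ℝ) : 0 ≤ l2Sq S := div_nonneg (frobSq_nonneg S) (sq_nonneg _)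

lemma frobSq_eq_trace {ι κ : Type*} [Fintype ι] [Fintype κ] (M : Matrix ι κ ℝ) :
    frobSq M = (Mᵀ * M).trace := by
  simp only [trace_transpose_mul_eq_sum, frobSq, sq]

lemma l2Sq_smul_add_smul (S T : Matrix V V ℝ) {a b : ℝ} (hab : a + b = 1) :
    l2Sq (a • S + b • T) = a * l2Sq S + b * l2Sq T - a * b * l2Sq (S - T) := by
  simp only [l2Sq, mul_div_assoc', ← add_div, ← sub_div, Finset.mul_sum, ← Finset.sum_add_distrib,
    ← Finset.sum_sub_distrib]
  congr! 3 with u _ v _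
  obtain rfl : b = 1 - a := by linarith
  simp only [Matrix.add_apply, Matrix.sub_apply, Matrix.smul_apply, smul_eq_mul]
  ring

variable [DecidableEq V] {n : ℕ} {W : Matrix V V ℝ} {ε εbar : ℝ} {x x' : Fin n → V}
  {y : Fin n → ℝ}

lemma l2Sq_sqrt_mul (hW : W.PosSemidef) (S : Matrix V V ℝ) :
    l2Sq (CFC.sqrt W * S) = (Sᵀ * W * S).trace / (Fintype.card V : ℝ) ^ 2 := by
  have hsymm : (CFC.sqrt W)ᵀ = CFC.sqrt W :=
    isSelfAdjoint_iff_isSymm.mp (CFC.sqrt_nonneg W).isSelfAdjoint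
  rw [l2Sq_eq_frobSq_div, frobSq_eq_trace, transpose_mul, hsymm, ← Matrix.mul_assoc,
    Matrix.mul_assoc Sᵀ, CFC.sqrt_mul_sqrt_self W hW.nonneg]

lemma sum_mul_eq_trace_transpose_noise_mul (S T : Matrix V V ℝ) :
    ∑ j, y j * T (x j) (x' j)
      = ((noise S x x' y)ᵀ * T).trace + n * ((Sᵀ * T).trace / (Fintype.card V : ℝ) ^ 2) := by
  have hsingle (j : Fin n) : ((single (x j) (x' j) (y j))ᵀ * T).trace = y j * T (x j) (x' j) := by
    rw [transpose_single, trace_single_mul]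
    rfl
  simp only [noise, transpose_sub, transpose_sum, transpose_smul, sub_mul, Finset.sum_mul, smul_mul,
    trace_sub, trace_sum, trace_smul, hsingle, smul_eq_mul]
  ring

lemma risk_sub_risk (hn : n ≠ 0) (S T : Matrix V V ℝ) :
    risk W ε εbar x x' y T - risk W ε εbar x x' y S
      = l2Sq (T - S) - 2 / n * ((noise S x x' y)ᵀ * (T - S)).trace
        + ε * (nuclearNorm T - nuclearNorm S)
        + εbar * (l2Sq (CFC.sqrt W * T) - l2Sq (CFC.sqrt W * S)) := by
  have hn' : (n : ℝ) ≠ 0 := Nat.cast_ne_zero.mpr hn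
  have hsq : l2Sq (T - S) = l2Sq T - l2Sq S
      - 2 * (Sᵀ * (T - S)).trace / (Fintype.card V : ℝ) ^ 2 := by
    have hcomm : (Tᵀ * S).trace = (Sᵀ * T).trace := by
      rw [← trace_transpose, transpose_mul, transpose_transpose]
    simp only [l2Sq_eq_frobSq_div, frobSq_eq_trace, transpose_sub, sub_mul, mul_sub, trace_sub,
      hcomm]
    ring
  have hlin : 2 / n * ∑ j, y j * T (x j) (x' j) - 2 / n * ∑ j, y j * S (x j) (x' j)
      = 2 / n * ((noise S x x' y)ᵀ * (T - S)).trace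
        + 2 * (Sᵀ * (T - S)).trace / (Fintype.card V : ℝ) ^ 2 := by
    have h := sum_mul_eq_trace_transpose_noise_mul (x := x) (x' := x') (y := y) S (T - S)
    simp only [Matrix.sub_apply, mul_sub, Finset.sum_sub_distrib] at h
    rw [← mul_sub, h, ← mul_sub, ← mul_sub, mul_add, ← mul_assoc _ (n : ℝ), div_mul_cancel₀ _ hn',
      mul_div_assoc]
  rw [risk, risk, hsq]
  linarith

lemma risk_smul_add_smul_le (hε : 0 ≤ ε) {S T : Matrix V V ℝ} (hS : S.IsSymm) (hT : T.IsSymm)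
    {a b : ℝ} (ha : 0 ≤ a) (hb : 0 ≤ b) (hab : a + b = 1) :
    risk W ε εbar x x' y (a • S + b • T)
      ≤ a * risk W ε εbar x x' y S + b * risk W ε εbar x x' y T
        - a * b * (l2Sq (S - T) + εbar * l2Sq (CFC.sqrt W * (S - T))) := by
  have hlin : ∑ j, y j * (a • S + b • T) (x j) (x' j)
      = a * ∑ j, y j * S (x j) (x' j) + b * ∑ j, y j * T (x j) (x' j) := by
    simp only [Finset.mul_sum, ← Finset.sum_add_distrib, Matrix.add_apply, Matrix.smul_apply,
      smul_eq_mul]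
    exact Finset.sum_congr rfl fun j _ => by ring
  have hnuc := mul_le_mul_of_nonneg_left (nuclearNorm_smul_add_smul_le hS hT ha hb) hε
  simp only [risk, mul_add, mul_sub, Matrix.mul_smul, hlin, l2Sq_smul_add_smul _ _ hab] at *
  linarith

lemma risk_add_le_of_isMinOn (hε : 0 ≤ ε) {D : Set (Matrix V V ℝ)} (hD : Convex ℝ D)
    (hsymm : ∀ S ∈ D, S.IsSymm) {S T : Matrix V V ℝ} (hS : S ∈ D) (hT : T ∈ D)
    (hmin : IsMinOn (risk W ε εbar x x' y) D T) :
    risk W ε εbar x x' y T + (l2Sq (T - S) + εbar * l2Sq (CFC.sqrt W * (T - S)))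
      ≤ risk W ε εbar x x' y S := by
  set q := l2Sq (T - S) + εbar * l2Sq (CFC.sqrt W * (T - S))
  have hconv : ∀ a ∈ Set.Ioo (0 : ℝ) 1,
      risk W ε εbar x x' y T + a * q ≤ risk W ε εbar x x' y S := fun a ha => by
    have ha' : 0 < 1 - a := sub_pos.mpr ha.2
    have hle := (hmin (hD hT hS ha.1.le ha'.le (add_sub_cancel a 1))).trans
      (risk_smul_add_smul_le hε (hsymm T hT) (hsymm S hS) ha.1.le ha'.le (add_sub_cancel a 1))
    refine le_of_mul_le_mul_left ?_ ha'
    linarith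
  have hlim : Filter.Tendsto (fun a : ℝ => risk W ε εbar x x' y T + a * q)
      (nhdsWithin 1 (Set.Iio 1)) (nhds (risk W ε εbar x x' y T + 1 * q)) :=
    (Continuous.tendsto (by fun_prop) 1).mono_left nhdsWithin_le_nhds
  rw [one_mul] at hlim
  exact le_of_tendsto hlim (Filter.eventually_of_mem (Ioo_mem_nhdsLT one_pos) hconv)

theorem basic_inequality (hn : n ≠ 0) (hε : 0 ≤ ε) {D : Set (Matrix V V ℝ)} (hD : Convex ℝ D)
    (hsymm : ∀ S ∈ D, S.IsSymm) {S T : Matrix V V ℝ} (hS : S ∈ D) (hT : T ∈ D)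
    (hmin : IsMinOn (risk W ε εbar x x' y) D T) :
    2 * l2Sq (T - S) + εbar * l2Sq (CFC.sqrt W * (T - S)) + εbar * l2Sq (CFC.sqrt W * T)
      ≤ 2 / n * ((noise S x x' y)ᵀ * (T - S)).trace + ε * (nuclearNorm S - nuclearNorm T)
        + εbar * l2Sq (CFC.sqrt W * S) := by
  have hgap := risk_add_le_of_isMinOn hε hD hsymm hS hT hmin
  have hsub := risk_sub_risk (W := W) (ε := ε) (εbar := εbar) (x := x) (x' := x') (y := y) hn S T
  linarith

end PenalizedRisk

section OracleInequality

open Matrix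
open scoped Matrix.Norms.L2Operator

variable {V κ : Type*} [Fintype V] [DecidableEq V] [Fintype κ] {W : Matrix V V ℝ} {εbar : ℝ}
  {R R' : Matrix κ V ℝ}

lemma mul_trace_transpose_mul_le {ι : Type*} [Fintype ι] (X Y : Matrix ι κ ℝ) (c : ℝ) {m : ℝ}
    (hm : 0 < m) :
    c * (Xᵀ * Y).trace ≤ c ^ 2 * m ^ 2 * frobSq X + frobSq Y / m ^ 2 / 4 := by
  simp only [trace_transpose_mul_eq_sum, frobSq, Finset.mul_sum, Finset.sum_div,
    ← Finset.sum_add_distrib]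
  gcongr with i _ j _
  have hsq := sq_nonneg (c * m * X i j - Y i j / m / 2)
  field_simp at hsq ⊢
  linarith

lemma frobSq_mul_div_eq (hW : W.PosSemidef) (hR' : R'ᵀ * R' = 1 + εbar • W) (Δ : Matrix V V ℝ) :
    frobSq (R' * Δ) / (Fintype.card V : ℝ) ^ 2 = l2Sq Δ + εbar * l2Sq (CFC.sqrt W * Δ) := by
  have hquad : (R' * Δ)ᵀ * (R' * Δ) = Δᵀ * Δ + εbar • (Δᵀ * W * Δ) := by
    rw [transpose_mul, Matrix.mul_assoc, ← Matrix.mul_assoc R'ᵀ, hR', Matrix.add_mul,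
      Matrix.mul_add, Matrix.one_mul, Matrix.smul_mul, Matrix.mul_smul, Matrix.mul_assoc]
  rw [l2Sq_sqrt_mul hW, l2Sq_eq_frobSq_div, frobSq_eq_trace, frobSq_eq_trace, hquad, trace_add,
    trace_smul, smul_eq_mul]
  ring

lemma mul_trace_transpose_mul_le_frobSq_add [Nonempty V] (hW : W.PosSemidef) (hRR' : Rᵀ * R' = 1)
    (hR' : R'ᵀ * R' = 1 + εbar • W) (M Δ : Matrix V V ℝ) (c : ℝ) :
    c * (Mᵀ * Δ).trace ≤ c ^ 2 * (Fintype.card V : ℝ) ^ 2 * frobSq (R * M)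
      + (l2Sq Δ + εbar * l2Sq (CFC.sqrt W * Δ)) / 4 := by
  have h := mul_trace_transpose_mul_le (R * M) (R' * Δ) c
    (Nat.cast_pos.mpr (Fintype.card_pos (α := V)))
  rwa [frobSq_mul_div_eq hW hR', transpose_mul, Matrix.mul_assoc, ← Matrix.mul_assoc Rᵀ, hRR',
    Matrix.one_mul] at h

lemma trace_transpose_mul_eq_add_add {P N Δ : Matrix V V ℝ} (hP : P.IsSymm) (hΔ : Δ.IsSymm) :
    (Nᵀ * Δ).trace = (Nᵀ * ((1 - P) * Δ * (1 - P))).trace + ((Nᵀ * P)ᵀ * Δ).trace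
      + (((1 - P) * N * P)ᵀ * Δ).trace := by
  have hQ : (1 - P)ᵀ = 1 - P := by rw [transpose_sub, transpose_one, hP]
  have hcorner : (Nᵀ * ((1 - P) * Δ * (1 - P))).trace = (((1 - P) * N * (1 - P))ᵀ * Δ).trace := by
    rw [transpose_mul, transpose_mul, hQ, ← mul_assoc, trace_mul_comm, ← mul_assoc]
    simp only [mul_assoc]
  have hrow : ((Nᵀ * P)ᵀ * Δ).trace = ((P * N)ᵀ * Δ).trace := by
    rw [← trace_transpose, transpose_mul, hΔ, transpose_transpose, trace_mul_comm,
      transpose_mul, hP]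
  have hsum : N = (1 - P) * N * (1 - P) + P * N + (1 - P) * N * P := by noncomm_ring
  rw [hcorner, hrow, ← trace_add, ← trace_add, ← add_mul, ← add_mul, ← transpose_add,
    ← transpose_add, ← hsum]

theorem oracle_inequality [Nonempty V] {b ε : ℝ} {S T N : Matrix V V ℝ} (hb : 0 < b)
    (hε : 0 < ε) (hεbar : 0 ≤ εbar) (hW : W.PosSemidef) (hS : S.IsSymm) (hT : T.IsSymm)
    (hRR' : Rᵀ * R' = 1) (hR' : R'ᵀ * R' = 1 + εbar • W) (hN : b * ‖N‖ ≤ ε)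
    (hbasic : 2 * l2Sq (T - S) + εbar * l2Sq (CFC.sqrt W * (T - S)) + εbar * l2Sq (CFC.sqrt W * T)
      ≤ b * (Nᵀ * (T - S)).trace + ε * (nuclearNorm S - nuclearNorm T)
        + εbar * l2Sq (CFC.sqrt W * S)) :
    l2Sq (T - S) ≤ ε ^ 2 * (Fintype.card V : ℝ) ^ 2 * frobSq (R * signMatrix S)
      + b ^ 2 * (Fintype.card V : ℝ) ^ 2 * (frobSq (R * (Nᵀ * suppProj S))
        + frobSq (R * ((1 - suppProj S) * N * suppProj S)))
      + εbar * l2Sq (CFC.sqrt W * S) := by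
  set P := suppProj S
  set Δ := T - S
  have hP : P.IsSymm := isSymm_suppProj S
  have hΔ : Δ.IsSymm := hT.sub hS
  have hcorner : ((1 - P) * Δ * (1 - P)).IsSymm := by
    rw [IsSymm, transpose_mul, transpose_mul, transpose_sub, transpose_one, hP, hΔ, ← mul_assoc]
  have hdual : b * (Nᵀ * ((1 - P) * Δ * (1 - P))).trace
      ≤ ε * nuclearNorm ((1 - P) * Δ * (1 - P)) := by
    have h := trace_transpose_mul_le_norm_mul_nuclearNorm hcorner (div_pos hε hb)
      ((le_div_iff₀' hb).mpr hN)
    rwa [div_mul_eq_mul_div, le_div_iff₀' hb] at h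
  have hsubgrad := mul_le_mul_of_nonneg_left (nuclearNorm_add_trace_add_nuclearNorm_le hS hT) hε.le
  have hsplit := congrArg (b * ·) (trace_transpose_mul_eq_add_add (N := N) hP hΔ)
  have hsign := mul_trace_transpose_mul_le_frobSq_add hW hRR' hR' (signMatrix S) Δ (-ε)
  have hrow := mul_trace_transpose_mul_le_frobSq_add hW hRR' hR' (Nᵀ * P) Δ b
  have hcol := mul_trace_transpose_mul_le_frobSq_add hW hRR' hR' ((1 - P) * N * P) Δ b
  have hnonneg := mul_nonneg hεbar (l2Sq_nonneg (CFC.sqrt W * T))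
  have hnonneg' := mul_nonneg hεbar (l2Sq_nonneg (CFC.sqrt W * Δ))
  have hΔ0 := l2Sq_nonneg Δ
  rw [isSymm_signMatrix] at hsign
  simp only [mul_add, neg_sq] at hsplit hsubgrad hsign hrow hcol ⊢
  linarith

end OracleInequality

section EffectiveDimension

lemma sum_mul_le_mul_sum_of_antitone {w d : ℕ → ℝ} {m : ℕ} (hm : 1 ≤ m)
    (hw : ∀ k, 1 ≤ k → k + 1 ≤ m → w (k + 1) ≤ w k)
    (hd : ∀ k ∈ Finset.Icc 1 m, ∑ j ∈ Finset.Icc 1 k, d j ≤ 0) :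
    ∑ k ∈ Finset.Icc 1 m, w k * d k ≤ w m * ∑ k ∈ Finset.Icc 1 m, d k := by
  induction m, hm using Nat.le_induction with
  | base => simp
  | succ m hm ih =>
    rw [Finset.sum_Icc_succ_top (by omega), Finset.sum_Icc_succ_top (by omega), mul_add]
    have hprev := ih (fun k hk hkm => hw k hk (by omega))
      fun k hk => hd k (Finset.Icc_subset_Icc_right m.le_succ hk)
    have hstep := mul_le_mul_of_nonpos_right (hw m hm le_rfl)
      (hd m (Finset.mem_Icc.mpr ⟨hm, m.le_succ⟩))
    linarith

lemma sum_mul_le_sum_mul_of_partial_sums_le {w a b : ℕ → ℝ} {m : ℕ}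
    (hw₀ : ∀ k ∈ Finset.Icc 1 m, 0 ≤ w k) (hw : ∀ k, 1 ≤ k → k + 1 ≤ m → w (k + 1) ≤ w k)
    (hab : ∀ k ∈ Finset.Icc 1 m, ∑ j ∈ Finset.Icc 1 k, a j ≤ ∑ j ∈ Finset.Icc 1 k, b j) :
    ∑ k ∈ Finset.Icc 1 m, w k * a k ≤ ∑ k ∈ Finset.Icc 1 m, w k * b k := by
  rcases m.eq_zero_or_pos with rfl | hm
  · simp
  have hd : ∀ k ∈ Finset.Icc 1 m, ∑ j ∈ Finset.Icc 1 k, (a j - b j) ≤ 0 := fun k hk => by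
    rw [Finset.sum_sub_distrib]
    exact sub_nonpos.mpr (hab k hk)
  have hmem : m ∈ Finset.Icc 1 m := Finset.mem_Icc.mpr ⟨hm, le_rfl⟩
  rw [← sub_nonpos, ← Finset.sum_sub_distrib]
  simp only [← mul_sub]
  exact (sum_mul_le_mul_sum_of_antitone hm hw hd).trans
    (mul_nonpos_of_nonneg_of_nonpos (hw₀ m hmem) (hd m hmem))

/-- The effective dimension `tr (1 + ε̄ W)⁻¹` of the regularization by `ε̄ W`, in terms of the
eigenvalues `λ₁, …, λ_m` of `W`. -/
def effectiveDim (m : ℕ) (lam : ℕ → ℝ) (εbar : ℝ) : ℝ :=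
  ∑ k ∈ Finset.Icc 1 m, (1 + εbar * lam k)⁻¹

variable {m s : ℕ} {lam : ℕ → ℝ} {c εbar : ℝ}

lemma inv_one_add_mul_le_one (hε : 0 ≤ εbar) {x : ℝ} (hx : 0 ≤ x) : (1 + εbar * x)⁻¹ ≤ 1 :=
  inv_le_one_of_one_le₀ (le_add_of_nonneg_right (mul_nonneg hε hx))

lemma sum_inv_one_add_tail_le (hs₀ : 0 < lam s)
    (hmono : ∀ k ∈ Finset.Icc s m, lam s ≤ lam k)
    (htail : ∑ k ∈ Finset.Icc s m, 1 / lam k ≤ c * (s / lam s)) (hε : (lam s)⁻¹ ≤ εbar) :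
    ∑ k ∈ Finset.Icc s m, (1 + εbar * lam k)⁻¹ ≤ c * s :=
  calc ∑ k ∈ Finset.Icc s m, (1 + εbar * lam k)⁻¹
    _ ≤ ∑ k ∈ Finset.Icc s m, lam s * (1 / lam k) := by
        refine Finset.sum_le_sum fun k hk => ?_
        have hk₀ : 0 < lam k := hs₀.trans_le (hmono k hk)
        rw [mul_one_div, ← inv_div, div_eq_mul_inv, mul_comm (lam k)]
        gcongr
        linarith [mul_le_mul_of_nonneg_right hε hk₀.le]
    _ ≤ lam s * (c * (s / lam s)) := by
        rw [← Finset.mul_sum]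
        gcongr
    _ = c * s := by field_simp

theorem effectiveDim_le (hc : 0 ≤ c) (hlam : ∀ k ∈ Finset.Icc 1 m, 0 ≤ lam k)
    (hmono : ∀ k ∈ Finset.Icc 1 m, ∀ l ∈ Finset.Icc 1 m, k ≤ l → lam k ≤ lam l)
    (hs : s ∈ Finset.Icc 1 (m + 1)) (hs₀ : s ≤ m → 0 < lam s)
    (htail : s ≤ m → ∑ k ∈ Finset.Icc s m, 1 / lam k ≤ c * (s / lam s)) (hε₀ : 0 ≤ εbar)
    (hε : invEig m lam s ≤ εbar) : effectiveDim m lam εbar ≤ (1 + c) * s := by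
  obtain ⟨hs1, hsm⟩ := Finset.mem_Icc.mp hs
  have hIcc (a : ℕ) : Finset.Icc a m = Finset.Ico a (m + 1) := by ext; simp
  have hhead : ∑ k ∈ Finset.Ico 1 s, (1 + εbar * lam k)⁻¹ ≤ s := by
    refine (Finset.sum_le_card_nsmul _ _ 1 fun k hk => ?_).trans (by simp)
    obtain ⟨hk, hks⟩ := Finset.mem_Ico.mp hk
    exact inv_one_add_mul_le_one hε₀ (hlam k (Finset.mem_Icc.mpr ⟨hk, by omega⟩))
  have htail' : ∑ k ∈ Finset.Icc s m, (1 + εbar * lam k)⁻¹ ≤ c * s := by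
    rcases le_or_gt s m with h | h
    · rw [invEig, if_pos h] at hε
      refine sum_inv_one_add_tail_le (hs₀ h) (fun k hk => ?_) (htail h) hε
      obtain ⟨hsk, hkm⟩ := Finset.mem_Icc.mp hk
      exact hmono s (Finset.mem_Icc.mpr ⟨hs1, h⟩) k (Finset.mem_Icc.mpr ⟨by omega, hkm⟩) hsk
    · rw [Finset.Icc_eq_empty (by omega), Finset.sum_empty]
      positivity
  rw [effectiveDim, hIcc, ← Finset.sum_Ico_consecutive _ hs1 hsm, ← hIcc]
  linarith

end EffectiveDimension

section SpectralWeights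

open Matrix

variable {V ι : Type*} [Fintype V] {W : Matrix V V ℝ} {lam : ℕ → ℝ}
  {phi : ℕ → EuclideanSpace ℝ V} {εbar : ℝ}

/-- The matrix with rows `φ₁, …, φ_m`, so that `W = Φᵀ diag(λ₁, …, λ_m) Φ`. -/
def eigenMatrix (phi : ℕ → EuclideanSpace ℝ V) :
    Matrix (Finset.Icc 1 (Fintype.card V)) V ℝ :=
  of fun k v => phi k v

/-- The square root `(1 + ε̄ Λ)^{-1/2} Φ` of `(1 + ε̄ W)⁻¹ = RᵀR`, where `W = Φᵀ Λ Φ`. -/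
def resolventSqrt (lam : ℕ → ℝ) (phi : ℕ → EuclideanSpace ℝ V) (εbar : ℝ) :
    Matrix (Finset.Icc 1 (Fintype.card V)) V ℝ :=
  diagonal (fun k : Finset.Icc 1 (Fintype.card V) => (√(1 + εbar * lam k))⁻¹) * eigenMatrix phi

/-- The square root `(1 + ε̄ Λ)^{1/2} Φ` of `1 + ε̄ W`, dual to `resolventSqrt`. -/
def resolventInvSqrt (lam : ℕ → ℝ) (phi : ℕ → EuclideanSpace ℝ V) (εbar : ℝ) :
    Matrix (Finset.Icc 1 (Fintype.card V)) V ℝ :=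
  diagonal (fun k : Finset.Icc 1 (Fintype.card V) => √(1 + εbar * lam k)) * eigenMatrix phi

namespace IsSpectralRepr

lemma one_le_one_add_mul (h : IsSpectralRepr W lam phi) (hε : 0 ≤ εbar) {k : ℕ}
    (hk : k ∈ Finset.Icc 1 (Fintype.card V)) : 1 ≤ 1 + εbar * lam k :=
  le_add_of_nonneg_right (mul_nonneg hε (h.nonneg k hk))

lemma mul_transpose_self (h : IsSpectralRepr W lam phi) :
    eigenMatrix phi * (eigenMatrix phi)ᵀ = 1 := by
  ext k l
  rw [one_apply, ← orthonormal_iff_ite.mp h.orthonormal k l, real_inner_comm,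
    EuclideanSpace.inner_eq_star_dotProduct]
  rfl

lemma eq_transpose_mul_diagonal_mul (h : IsSpectralRepr W lam phi) :
    W = (eigenMatrix phi)ᵀ * diagonal (fun k : Finset.Icc 1 (Fintype.card V) => lam k)
      * eigenMatrix phi := by
  rw [h.eq_sum, ← Finset.sum_coe_sort]
  ext u v
  rw [mul_apply]
  simp only [Matrix.sum_apply, Matrix.smul_apply, vecMulVec_apply, smul_eq_mul,
    mul_diagonal, eigenMatrix, of_apply, transpose_apply]
  exact Finset.sum_congr rfl fun k _ => by ring

lemma posSemidef (h : IsSpectralRepr W lam phi) : W.PosSemidef := by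
  rw [h.eq_transpose_mul_diagonal_mul, ← conjTranspose_eq_transpose_of_trivial]
  refine (PosSemidef.diagonal fun k : Finset.Icc 1 (Fintype.card V) =>
    ?_).conjTranspose_mul_mul_same _
  exact h.nonneg k k.2

lemma frobSq_resolventSqrt_mul [Fintype ι] (h : IsSpectralRepr W lam phi) (hε : 0 ≤ εbar)
    (M : Matrix V ι ℝ) :
    frobSq (resolventSqrt lam phi εbar * M)
      = ∑ k ∈ Finset.Icc 1 (Fintype.card V),
        (1 + εbar * lam k)⁻¹ * ∑ i, (Mᵀ *ᵥ phi k) i ^ 2 := by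
  rw [← Finset.sum_coe_sort, frobSq]
  refine Finset.sum_congr rfl fun k _ => ?_
  rw [Finset.mul_sum]
  refine Finset.sum_congr rfl fun i _ => ?_
  rw [resolventSqrt, Matrix.mul_assoc, diagonal_mul, mul_pow, inv_pow,
    Real.sq_sqrt (zero_le_one.trans (h.one_le_one_add_mul hε k.2)), mulVec_transpose, mul_apply,
    vecMul, dotProduct]
  rfl

variable [DecidableEq V]

lemma transpose_mul_self (h : IsSpectralRepr W lam phi) :
    (eigenMatrix phi)ᵀ * eigenMatrix phi = 1 :=
  (mul_eq_one_comm_of_card_eq _ _ _ (by simp)).mp h.mul_transpose_self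

lemma transpose_resolventSqrt_mul (h : IsSpectralRepr W lam phi) (hε : 0 ≤ εbar) :
    (resolventSqrt lam phi εbar)ᵀ * resolventInvSqrt lam phi εbar = 1 := by
  have hdiag : diagonal (fun k : Finset.Icc 1 (Fintype.card V) => (√(1 + εbar * lam k))⁻¹)
      * diagonal (fun k : Finset.Icc 1 (Fintype.card V) => √(1 + εbar * lam k)) = 1 := by
    rw [diagonal_mul_diagonal, ← diagonal_one]
    congr! with k
    exact inv_mul_cancel₀ (Real.sqrt_pos.mpr (one_pos.trans_le (h.one_le_one_add_mul hε k.2))).ne'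
  rw [resolventSqrt, resolventInvSqrt, transpose_mul, diagonal_transpose, Matrix.mul_assoc,
    ← Matrix.mul_assoc (diagonal _), hdiag, Matrix.one_mul, h.transpose_mul_self]

lemma transpose_resolventInvSqrt_mul_self (h : IsSpectralRepr W lam phi) (hε : 0 ≤ εbar) :
    (resolventInvSqrt lam phi εbar)ᵀ * resolventInvSqrt lam phi εbar = 1 + εbar • W := by
  have hdiag : diagonal (fun k : Finset.Icc 1 (Fintype.card V) => √(1 + εbar * lam k))
      * diagonal (fun k : Finset.Icc 1 (Fintype.card V) => √(1 + εbar * lam k))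
      = 1 + εbar • diagonal (fun k : Finset.Icc 1 (Fintype.card V) => lam k) := by
    rw [diagonal_mul_diagonal, ← diagonal_one, ← diagonal_smul, diagonal_add]
    congr! 2 with k
    exact Real.mul_self_sqrt (zero_le_one.trans (h.one_le_one_add_mul hε k.2))
  conv_rhs => rw [h.eq_transpose_mul_diagonal_mul]
  rw [resolventInvSqrt, transpose_mul, diagonal_transpose, Matrix.mul_assoc,
    ← Matrix.mul_assoc (diagonal _), hdiag, Matrix.add_mul, Matrix.mul_add, Matrix.one_mul,
    h.transpose_mul_self, Matrix.smul_mul, Matrix.mul_smul, Matrix.mul_assoc]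

omit [DecidableEq V] in
lemma sum_sq_eigenMatrix_mul (h : IsSpectralRepr W lam phi) (M : Matrix V ι ℝ) (i : ι) :
    ∑ k, (eigenMatrix phi * M) k i ^ 2 = ∑ v, M v i ^ 2 := by
  classical
  have hM : (eigenMatrix phi * M)ᵀ * (eigenMatrix phi * M) = Mᵀ * M := by
    rw [transpose_mul, Matrix.mul_assoc, ← Matrix.mul_assoc _ (eigenMatrix phi),
      h.transpose_mul_self, Matrix.one_mul]
  simpa only [mul_apply, transpose_apply, ← sq] using congrFun₂ hM i i

omit [DecidableEq V] in
lemma sum_sq_resolventSqrt_mul_le (h : IsSpectralRepr W lam phi) (hε : 0 ≤ εbar)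
    (M : Matrix V ι ℝ) (i : ι) :
    ∑ k, (resolventSqrt lam phi εbar * M) k i ^ 2 ≤ ∑ v, M v i ^ 2 := by
  classical
  rw [← h.sum_sq_eigenMatrix_mul]
  refine Finset.sum_le_sum fun k _ => ?_
  have hk := h.one_le_one_add_mul hε k.2
  rw [resolventSqrt, Matrix.mul_assoc, diagonal_mul, mul_pow, inv_pow,
    Real.sq_sqrt (zero_le_one.trans hk)]
  exact mul_le_of_le_one_left (sq_nonneg _) (inv_le_one_of_one_le₀ hk)

omit [DecidableEq V] in
lemma frobSq_resolventSqrt (h : IsSpectralRepr W lam phi) (hε : 0 ≤ εbar) :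
    frobSq (resolventSqrt lam phi εbar) = effectiveDim (Fintype.card V) lam εbar := by
  classical
  rw [← Matrix.mul_one (resolventSqrt lam phi εbar), h.frobSq_resolventSqrt_mul hε, effectiveDim]
  refine Finset.sum_congr rfl fun k hk => ?_
  have hnorm : ‖phi k‖ = 1 := h.orthonormal.1 ⟨k, hk⟩
  rw [transpose_one, one_mulVec, ← EuclideanSpace.real_norm_sq_eq, hnorm, one_pow, mul_one]

end IsSpectralRepr

end SpectralWeights

section Coherence

open Matrix

variable {V κ : Type*} [Fintype V]

lemma sum_sq_apply_of_isStarProjection {P : Matrix V V ℝ} (hP : IsStarProjection P) (v : V) :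
    ∑ u, P u v ^ 2 = P v v := by
  have hsymm : P.IsSymm := isSelfAdjoint_iff_isSymm.mp hP.isSelfAdjoint
  conv_rhs => rw [← hP.isIdempotentElem.eq, mul_apply]
  exact Finset.sum_congr rfl fun u _ => by rw [hsymm.apply, sq]

lemma frobSq_eq_trace_mul_transpose [Fintype κ] (M : Matrix κ V ℝ) :
    frobSq M = (M * Mᵀ).trace := by
  rw [← frobSq_transpose, frobSq_eq_trace, transpose_transpose]

lemma frobSq_mul_of_isStarProjection [Fintype κ] (R : Matrix κ V ℝ) {P : Matrix V V ℝ}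
    (hP : IsStarProjection P) : frobSq (R * P) = (R * P * Rᵀ).trace := by
  have hsymm : P.IsSymm := isSelfAdjoint_iff_isSymm.mp hP.isSelfAdjoint
  rw [frobSq_eq_trace_mul_transpose, transpose_mul, hsymm, ← Matrix.mul_assoc, Matrix.mul_assoc R,
    hP.isIdempotentElem.eq]

variable [DecidableEq V] {S : Matrix V V ℝ}

lemma projSq_le_maxCoherence (L : Submodule ℝ (EuclideanSpace ℝ V)) (v : V) :
    projSq L (EuclideanSpace.single v 1) ≤ maxCoherence L :=
  le_ciSup (f := fun v : V => projSq L (EuclideanSpace.single v 1)) (Set.finite_range _).bddAbove v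

lemma sum_sq_one_sub_suppProj_le_one (S : Matrix V V ℝ) (v : V) :
    ∑ u, (1 - suppProj S) u v ^ 2 ≤ 1 := by
  rw [sum_sq_apply_of_isStarProjection (isStarProjection_suppProj S).one_sub,
    Matrix.sub_apply, one_apply_eq, sub_le_self_iff,
    ← sum_sq_apply_of_isStarProjection (isStarProjection_suppProj S)]
  exact Finset.sum_nonneg fun _ _ => sq_nonneg _

lemma sum_sq_suppProj_le_maxCoherence (hS : S.IsSymm) (v : V) :
    ∑ u, suppProj S u v ^ 2 ≤ maxCoherence (supp S) := by
  refine le_trans (le_of_eq ?_) (projSq_le_maxCoherence (supp S) v)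
  rw [projSq_supp hS, PiLp.ofLp_single, mulVec_single_one]
  rfl

lemma frobSq_suppProj (hS : S.IsSymm) : frobSq (suppProj S) = S.rank := by
  rw [frobSq_eq_trace, isSymm_suppProj, suppProj_mul_self, trace_suppProj hS]

lemma maxCoherence_supp_pos (hS : S.IsSymm) (hr : 0 < S.rank) : 0 < maxCoherence (supp S) := by
  have hr' : (0 : ℝ) < S.rank := Nat.cast_pos.mpr hr
  rw [← frobSq_suppProj hS, ← frobSq_transpose] at hr'
  obtain ⟨v, -, hv⟩ := Finset.exists_lt_of_sum_lt (s := Finset.univ) (f := fun _ : V => (0 : ℝ))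
    (Finset.sum_const_zero.trans_lt hr')
  exact hv.trans_le (sum_sq_suppProj_le_maxCoherence hS v)

variable [Fintype κ]

lemma frobSq_mul_signMatrix (R : Matrix κ V ℝ) (S : Matrix V V ℝ) :
    frobSq (R * signMatrix S) = frobSq (R * suppProj S) := by
  rw [frobSq_mul_of_isStarProjection R (isStarProjection_suppProj S),
    frobSq_eq_trace_mul_transpose, transpose_mul, isSymm_signMatrix, ← Matrix.mul_assoc,
    Matrix.mul_assoc R, suppProj]

lemma frobSq_mul_suppProj_add_frobSq_mul_one_sub (R : Matrix κ V ℝ) (S : Matrix V V ℝ) :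
    frobSq (R * suppProj S) + frobSq (R * (1 - suppProj S)) = frobSq R := by
  have hP := isStarProjection_suppProj S
  rw [frobSq_mul_of_isStarProjection R hP, frobSq_mul_of_isStarProjection R hP.one_sub,
    frobSq_eq_trace_mul_transpose, ← trace_add, ← Matrix.add_mul, ← Matrix.mul_add,
    add_sub_cancel, Matrix.mul_one]

namespace IsSpectralRepr

variable {W : Matrix V V ℝ} {lam : ℕ → ℝ} {phi : ℕ → EuclideanSpace ℝ V} {εbar a : ℝ}

theorem frobSq_resolventSqrt_mul_signMatrix_le (h : IsSpectralRepr W lam phi) (hε : 0 ≤ εbar)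
    (hS : S.IsSymm) (hcoh : ∀ k ∈ Finset.Icc 1 (Fintype.card V),
      ∑ j ∈ Finset.Icc 1 k, projSq (supp S) (phi j) ≤ a * k) :
    frobSq (resolventSqrt lam phi εbar * signMatrix S)
      ≤ a * effectiveDim (Fintype.card V) lam εbar := by
  have hpos {k : ℕ} (hk : k ∈ Finset.Icc 1 (Fintype.card V)) : 0 < 1 + εbar * lam k :=
    one_pos.trans_le (h.one_le_one_add_mul hε hk)
  calc frobSq (resolventSqrt lam phi εbar * signMatrix S)
    _ = ∑ k ∈ Finset.Icc 1 (Fintype.card V), (1 + εbar * lam k)⁻¹ * projSq (supp S) (phi k) := by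
        rw [frobSq_mul_signMatrix, h.frobSq_resolventSqrt_mul hε, isSymm_suppProj]
        simp only [projSq_supp hS]
    _ ≤ ∑ k ∈ Finset.Icc 1 (Fintype.card V), (1 + εbar * lam k)⁻¹ * a := by
        refine sum_mul_le_sum_mul_of_partial_sums_le (fun k hk => (inv_pos.mpr (hpos hk)).le)
          (fun k hk hkm => ?_) fun k hk => ?_
        · have hk₁ : k ∈ Finset.Icc 1 (Fintype.card V) := Finset.mem_Icc.mpr ⟨hk, by omega⟩
          have hk₂ : k + 1 ∈ Finset.Icc 1 (Fintype.card V) := Finset.mem_Icc.mpr ⟨by omega, hkm⟩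
          have hle := h.mono k hk₁ (k + 1) hk₂ k.le_succ
          have := hpos hk₁
          gcongr
        · refine (hcoh k hk).trans_eq ?_
          rw [Finset.sum_const, Nat.card_Icc, Nat.add_sub_cancel, nsmul_eq_mul, mul_comm]
    _ = a * effectiveDim (Fintype.card V) lam εbar := by
        rw [effectiveDim, Finset.mul_sum]
        exact Finset.sum_congr rfl fun k _ => mul_comm _ _

end IsSpectralRepr

namespace IsSample

variable [MeasurableSpace V] [MeasurableSingletonClass V] {Ω : Type*} [MeasurableSpace Ω]
  {μ : Measure Ω} [IsProbabilityMeasure μ] {n : ℕ} {X X' : Fin n → Ω → V} {Y : Fin n → Ω → ℝ}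
  [Nonempty V] [Nonempty κ] {s : ℝ}

theorem measureReal_lt_frobSq_mul_transpose_noise_mul_le (h : IsSample μ S X X' Y)
    (hS : S.IsSymm) (hr : 0 < S.rank) {R : Matrix κ V ℝ} (hR : ∀ v, ∑ k, R k v ^ 2 ≤ 1)
    (hs : 0 < s) :
    μ.real {ω | 8 * n * (S.rank * frobSq R / (Fintype.card V : ℝ) ^ 2) * s
          + 32 * maxCoherence (supp S) * s ^ 2
        < frobSq (R * ((noise S (X · ω) (X' · ω) (Y · ω))ᵀ * suppProj S))}
      ≤ (Fintype.card κ * Fintype.card V + 1) * Real.exp (-s) := by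
  have hρ := maxCoherence_supp_pos hS hr
  have htail := h.measureReal_lt_frobSq_mul_noise_mul_le (suppProj S) Rᵀ (Real.sqrt_pos.mpr hρ) hs
    fun u v => by
      rw [Real.sq_sqrt hρ.le]
      exact (mul_le_of_le_one_right (Finset.sum_nonneg fun _ _ => sq_nonneg _) (hR v)).trans
        (sum_sq_suppProj_le_maxCoherence hS u)
  rw [Real.sq_sqrt hρ.le, frobSq_suppProj hS, frobSq_transpose] at htail
  convert htail using 7 with ω
  rw [← frobSq_transpose, transpose_mul, transpose_mul, transpose_transpose, isSymm_suppProj]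

theorem measureReal_lt_frobSq_mul_one_sub_mul_noise_mul_le (h : IsSample μ S X X' Y)
    (hS : S.IsSymm) (hr : 0 < S.rank) {R : Matrix κ V ℝ}
    (hR : ∀ v, ∑ k, (R * (1 - suppProj S) : Matrix κ V ℝ) k v ^ 2 ≤ 1) (hs : 0 < s) :
    μ.real {ω | 8 * n * (S.rank * frobSq R / (Fintype.card V : ℝ) ^ 2) * s
          + 32 * maxCoherence (supp S) * s ^ 2
        < frobSq (R * ((1 - suppProj S) * noise S (X · ω) (X' · ω) (Y · ω) * suppProj S))}
      ≤ (Fintype.card κ * Fintype.card V + 1) * Real.exp (-s) := by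
  have hρ := maxCoherence_supp_pos hS hr
  have htail := h.measureReal_lt_frobSq_mul_noise_mul_le (R * (1 - suppProj S)) (suppProj S)
    (Real.sqrt_pos.mpr hρ) hs fun u v => by
      rw [Real.sq_sqrt hρ.le]
      refine (mul_le_of_le_one_left (Finset.sum_nonneg fun _ _ => sq_nonneg _) (hR u)).trans ?_
      simpa only [(isSymm_suppProj S).apply] using sum_sq_suppProj_le_maxCoherence hS v
  rw [Real.sq_sqrt hρ.le, frobSq_suppProj hS, mul_comm (frobSq _),
    mul_comm (Fintype.card V : ℝ)] at htail
  simp only [Matrix.mul_assoc] at htail ⊢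
  refine (measureReal_mono (Set.ofPred_subset_ofPred.mpr fun ω => lt_of_le_of_lt ?_)).trans htail
  gcongr
  rw [← frobSq_mul_suppProj_add_frobSq_mul_one_sub R S]
  exact le_add_of_nonneg_left (frobSq_nonneg _)

end IsSample

end Coherence

section Calibration

variable {n m : ℕ} {t ζ u : ℝ}

lemma add_log_two_mul_pos (ht : 0 < t) (m : ℕ) : 0 < t + Real.log (2 * m) := by
  have hlog := Real.log_natCast_nonneg (2 * m)
  push_cast at hlog
  linarith

lemma add_log_two_mul_le (hm : 0 < m) (hu : t + Real.log (8 * m) ≤ u) :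
    t + Real.log (2 * m) ≤ u := by
  refine le_trans ?_ hu
  gcongr
  norm_num

lemma regEps_pos (ht : 0 < t) (hn : 0 < n) (hm : 0 < m) : 0 < regEps t n m := by
  have := add_log_two_mul_pos ht m
  rw [regEps]
  positivity

lemma regEps_sq (ht : 0 < t) (n m : ℕ) :
    regEps t n m ^ 2 = 16 * ((t + Real.log (2 * m)) / (n * m)) := by
  have := add_log_two_mul_pos ht m
  rw [regEps, mul_pow, Real.sq_sqrt (by positivity)]
  norm_num

lemma two_div_mul_two_mul_sqrt (t : ℝ) (hn : 0 < n) (m : ℕ) :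
    2 / n * (2 * √(n * (m : ℝ)⁻¹ * (t + Real.log (2 * m)))) = regEps t n m := by
  have hn' : (0 : ℝ) < n := Nat.cast_pos.mpr hn
  have hscale : (n : ℝ) * (m : ℝ)⁻¹ * (t + Real.log (2 * m))
      = n ^ 2 * ((t + Real.log (2 * m)) / (n * m)) := by
    field_simp
  rw [hscale, Real.sqrt_mul (sq_nonneg _), Real.sqrt_sq hn'.le, regEps]
  field_simp
  ring

lemma two_le_logb (hζ : 0 ≤ ζ) (hn : 0 < n) (hm : 0 < m) :
    2 ≤ Real.logb 2 (4 * (n : ℝ) ^ ζ * (m : ℝ) ^ (3 / 2 * ζ)) := by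
  have hn₁ : 1 ≤ (n : ℝ) ^ ζ := Real.one_le_rpow (Nat.one_le_cast.mpr hn) hζ
  have hm₁ : 1 ≤ (m : ℝ) ^ (3 / 2 * ζ) :=
    Real.one_le_rpow (Nat.one_le_cast.mpr hm) (by positivity)
  rw [Real.le_logb_iff_rpow_le one_lt_two (by positivity), mul_assoc]
  linarith [one_le_mul_of_one_le_of_one_le hn₁ hm₁, Real.rpow_two (2 : ℝ)]

lemma tnm_zero_pos (ht : 0 < t) (hζ : ζ ≠ 0) (m : ℕ) : 0 < tnm t ζ 0 m := by
  have hlog := Real.log_natCast_nonneg (2 * m * 2)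
  push_cast at hlog
  rw [tnm, Nat.cast_zero, Real.zero_rpow hζ, mul_zero, zero_mul, Real.logb_zero, zero_add]
  linarith

lemma add_log_eight_mul_le_tnm (ht : 0 < t) (hζ : 0 < ζ) (h : m * tnm t ζ n m ≤ n) :
    t + Real.log (8 * m) ≤ tnm t ζ n m := by
  rcases m.eq_zero_or_pos with rfl | hm
  · simp [tnm]
  have hm' : (0 : ℝ) < m := Nat.cast_pos.mpr hm
  rcases n.eq_zero_or_pos with rfl | hn
  · rw [Nat.cast_zero] at h
    exact absurd h (mul_pos hm' (tnm_zero_pos ht hζ.ne' m)).not_ge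
  have hlogb := two_le_logb hζ.le hn hm
  refine add_le_add_right (Real.log_le_log (by positivity) ?_) t
  nlinarith

-- A Bernstein exponent above `1` saves the fraction `0.005` of `exp (-t)` for the two other failure
-- events; these are taken at level `10 u`, which costs only constants in the error bound.
lemma norm_failure_le {t m : ℝ} (ht : 0 ≤ t) (hm : 1 ≤ m) :
    2 * m * Real.exp (-(1.01 * (t + Real.log (2 * m)))) ≤ 0.995 * Real.exp (-t) := by
  have hlog : 0.69 ≤ Real.log (2 * m) :=
    (by norm_num : (0.69 : ℝ) ≤ 0.6931471803).trans
      (Real.log_two_gt_d9.le.trans (Real.log_le_log two_pos (by linarith)))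
  calc 2 * m * Real.exp (-(1.01 * (t + Real.log (2 * m))))
    _ = Real.exp (-(0.01 * (t + Real.log (2 * m)))) * Real.exp (-t) := by
        conv_lhs => rw [← Real.exp_log (show 0 < 2 * m by positivity)]
        rw [← Real.exp_add, ← Real.exp_add, Real.log_exp]
        ring_nf
    _ ≤ Real.exp (-0.0069) * Real.exp (-t) := by
        gcongr
        linarith
    _ ≤ 0.995 * Real.exp (-t) := by
        gcongr
        rw [Real.exp_neg, inv_le_comm₀ (Real.exp_pos _) (by norm_num)]
        exact (by norm_num : (0.995 : ℝ)⁻¹ ≤ 0.0069 + 1).trans (Real.add_one_le_exp _)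

lemma frobSq_failure_le {t u m : ℝ} (ht : 0 ≤ t) (hm : 1 ≤ m) (hu : t + Real.log (8 * m) ≤ u) :
    2 * ((m * m + 1) * Real.exp (-(10 * u))) ≤ 0.005 * Real.exp (-t) :=
  calc 2 * ((m * m + 1) * Real.exp (-(10 * u)))
    _ ≤ 2 * ((m * m + 1) * Real.exp (-t + (10 : ℕ) * -Real.log (8 * m))) := by
        gcongr
        push_cast
        linarith
    _ = 2 * (m * m + 1) * ((8 * m) ^ 10)⁻¹ * Real.exp (-t) := by
        rw [Real.exp_add, Real.exp_nat_mul, Real.exp_neg (Real.log _),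
          Real.exp_log (by positivity), inv_pow]
        ring
    _ ≤ 0.005 * Real.exp (-t) := by
        gcongr
        rw [← div_eq_mul_inv, div_le_iff₀ (by positivity), mul_pow]
        have hm₂ : 1 ≤ m ^ 2 := one_le_pow₀ hm
        have hm₁₀ : m ^ 2 ≤ m ^ 10 := pow_le_pow_right₀ hm (by norm_num)
        linarith

end Calibration

section ErrorBound

open Matrix
open scoped Matrix.Norms.L2Operator

variable {V : Type*} [Fintype V] [DecidableEq V] {n : ℕ} {t u εbar ν : ℝ} {W S T : Matrix V V ℝ}
  {lam : ℕ → ℝ} {phi : ℕ → EuclideanSpace ℝ V}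

lemma error_terms_le {n m : ℕ} {r d ρ f₁ f₂ f₃ : ℝ} (hn : 0 < n) (hm : 0 < m) (ht : 0 < t)
    (hu : t + Real.log (8 * m) ≤ u) (hν : 1 ≤ ν) (hr : 0 ≤ r) (hd : 0 ≤ d)
    (hf₁ : f₁ ≤ ν * r / m * d)
    (hf₂ : f₂ ≤ 8 * n * (r * d / m ^ 2) * (10 * u) + 32 * ρ * (10 * u) ^ 2)
    (hf₃ : f₃ ≤ 8 * n * (r * d / m ^ 2) * (10 * u) + 32 * ρ * (10 * u) ^ 2) :
    regEps t n m ^ 2 * (m : ℝ) ^ 2 * f₁ + (2 / n) ^ 2 * (m : ℝ) ^ 2 * (f₂ + f₃)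
      ≤ 656 * (ν * r * d * u / n) + 25600 * ρ * (m * u / n) ^ 2 := by
  have hτ := add_log_two_mul_pos ht m
  have hτu := add_log_two_mul_le hm hu
  have hu₀ : 0 ≤ u := (hτ.trans_le hτu).le
  have hsum := (add_le_add hf₂ hf₃).trans_eq (two_mul _).symm
  calc regEps t n m ^ 2 * (m : ℝ) ^ 2 * f₁ + (2 / n) ^ 2 * (m : ℝ) ^ 2 * (f₂ + f₃)
    _ ≤ 16 * ((t + Real.log (2 * m)) / (n * m)) * (m : ℝ) ^ 2 * (ν * r / m * d)
        + (2 / n) ^ 2 * (m : ℝ) ^ 2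
          * (2 * (8 * n * (r * d / m ^ 2) * (10 * u) + 32 * ρ * (10 * u) ^ 2)) := by
        rw [regEps_sq ht]
        gcongr
    _ ≤ 16 * (u / (n * m)) * (m : ℝ) ^ 2 * (ν * r / m * d) + (2 / n) ^ 2 * (m : ℝ) ^ 2
        * (2 * (8 * n * (r * d / m ^ 2) * (10 * u) + 32 * ρ * (10 * u) ^ 2)) := by
        gcongr
    _ = 16 * (ν * r * d * u / n) + 640 * (1 * r * d * u / n)
        + 25600 * ρ * (m * u / n) ^ 2 := by
        field_simp
        ring
    _ ≤ 16 * (ν * r * d * u / n) + 640 * (ν * r * d * u / n)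
        + 25600 * ρ * (m * u / n) ^ 2 := by
        gcongr
    _ = 656 * (ν * r * d * u / n) + 25600 * ρ * (m * u / n) ^ 2 := by ring

theorem l2Sq_sub_le_of_noise_le [Nonempty V] {x x' : Fin n → V} {y : Fin n → ℝ}
    (hW : IsSpectralRepr W lam phi) (hεbar : 0 ≤ εbar) (hS : S.IsSymm) (hν : 1 ≤ ν)
    (hcoh : ∀ k ∈ Finset.Icc 1 (Fintype.card V),
      ∑ j ∈ Finset.Icc 1 k, projSq (supp S) (phi j) ≤ ν * S.rank * k / Fintype.card V)
    (ht : 0 < t) (hu : t + Real.log (8 * Fintype.card V) ≤ u) (hn : 0 < n)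
    {D : Set (Matrix V V ℝ)} (hD : Convex ℝ D) (hDsymm : ∀ S ∈ D, S.IsSymm) (hSD : S ∈ D)
    (hTD : T ∈ D)
    (hmin : IsMinOn (risk W (regEps t n (Fintype.card V)) εbar x x' y) D T)
    (hnorm : ‖noise S x x' y‖
      ≤ 2 * √(n * (Fintype.card V : ℝ)⁻¹ * (t + Real.log (2 * Fintype.card V))))
    (hleft : frobSq (resolventSqrt lam phi εbar * ((noise S x x' y)ᵀ * suppProj S))
      ≤ 8 * n * (S.rank * effectiveDim (Fintype.card V) lam εbar / (Fintype.card V : ℝ) ^ 2)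
        * (10 * u) + 32 * maxCoherence (supp S) * (10 * u) ^ 2)
    (hright : frobSq (resolventSqrt lam phi εbar
        * ((1 - suppProj S) * noise S x x' y * suppProj S))
      ≤ 8 * n * (S.rank * effectiveDim (Fintype.card V) lam εbar / (Fintype.card V : ℝ) ^ 2)
        * (10 * u) + 32 * maxCoherence (supp S) * (10 * u) ^ 2) :
    l2Sq (T - S)
      ≤ 656 * (ν * S.rank * effectiveDim (Fintype.card V) lam εbar * u / n)
        + 25600 * maxCoherence (supp S) * (Fintype.card V * u / n) ^ 2
        + εbar * l2Sq (CFC.sqrt W * S) := by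
  have hε := regEps_pos ht hn (Fintype.card_pos (α := V))
  have hsign := hW.frobSq_resolventSqrt_mul_signMatrix_le (a := ν * S.rank / Fintype.card V)
    hεbar hS fun k hk => (hcoh k hk).trans_eq (by ring)
  have hdim : 0 ≤ effectiveDim (Fintype.card V) lam εbar := by
    rw [← hW.frobSq_resolventSqrt hεbar]
    exact frobSq_nonneg _
  have horacle := oracle_inequality (b := 2 / n) (by positivity) hε hεbar hW.posSemidef hS
    (hDsymm T hTD) (hW.transpose_resolventSqrt_mul hεbar)
    (hW.transpose_resolventInvSqrt_mul_self hεbar)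
    ((mul_le_mul_of_nonneg_left hnorm (by positivity)).trans_eq (two_div_mul_two_mul_sqrt t hn _))
    (basic_inequality hn.ne' hε.le hD hDsymm hSD hTD hmin)
  have herror := error_terms_le hn (Fintype.card_pos (α := V)) ht hu hν S.rank.cast_nonneg hdim
    hsign hleft hright
  exact horacle.trans (by gcongr)

end ErrorBound

section HighProbability

open Matrix
open scoped Matrix.Norms.L2Operator

lemma one_sub_le_measureReal_of_union {Ω : Type*} [MeasurableSpace Ω] {μ : Measure Ω}
    [IsProbabilityMeasure μ] {A B C G : Set Ω} {a b c δ : ℝ} (hA : μ.real A ≤ a)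
    (hB : μ.real B ≤ b) (hC : μ.real C ≤ c) (hδ : a + (b + c) ≤ δ)
    (h : ∀ ω, ω ∉ A → ω ∉ B → ω ∉ C → ω ∈ G) : 1 - δ ≤ μ.real G := by
  have hcover : (Set.univ : Set Ω) ⊆ G ∪ (A ∪ (B ∪ C)) := fun ω _ => by
    simp only [Set.mem_union]
    by_contra! hω
    exact hω.1 (h ω hω.2.1 hω.2.2.1 hω.2.2.2)
  have huniv := (measureReal_mono (μ := μ) hcover).trans (measureReal_union_le _ _)
  rw [probReal_univ] at huniv
  linarith [measureReal_union_le (μ := μ) A (B ∪ C), measureReal_union_le (μ := μ) B C]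

variable {V : Type*} [Fintype V] [DecidableEq V] [MeasurableSpace V] [MeasurableSingletonClass V]
  {Ω : Type*} [MeasurableSpace Ω] {μ : Measure Ω} [IsProbabilityMeasure μ] {n : ℕ}
  {t u εbar ν : ℝ} {W S : Matrix V V ℝ} {lam : ℕ → ℝ} {phi : ℕ → EuclideanSpace ℝ V}

theorem one_sub_exp_neg_le_measureReal_l2Sq_sub_le
    (hW : IsSpectralRepr W lam phi) (hεbar : 0 ≤ εbar) (hS : S.IsSymm) (hr : 1 ≤ S.rank)
    (hν : 1 ≤ ν)
    (hcoh : ∀ k ∈ Finset.Icc 1 (Fintype.card V),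
      ∑ j ∈ Finset.Icc 1 k, projSq (supp S) (phi j) ≤ ν * S.rank * k / Fintype.card V)
    {D : Set (Matrix V V ℝ)} (hD : Convex ℝ D) (hDsymm : ∀ T ∈ D, T.IsSymm) (hSD : S ∈ D)
    (ht : 0 < t) (hu : t + Real.log (8 * Fintype.card V) ≤ u) (hun : Fintype.card V * u ≤ n)
    {X X' : Fin n → Ω → V} {Y : Fin n → Ω → ℝ} (hsample : IsSample μ S X X' Y)
    {Shat : Ω → Matrix V V ℝ}
    (hmin : ∀ ω, Shat ω ∈ D ∧
      IsMinOn (risk W (regEps t n (Fintype.card V)) εbar (X · ω) (X' · ω) (Y · ω)) D (Shat ω)) :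
    1 - Real.exp (-t) ≤ μ.real {ω |
      l2Sq (Shat ω - S)
        ≤ 656 * (ν * S.rank * effectiveDim (Fintype.card V) lam εbar * u / n)
          + 25600 * maxCoherence (supp S) * (Fintype.card V * u / n) ^ 2
          + εbar * l2Sq (CFC.sqrt W * S)} := by
  have hm : 0 < Fintype.card V := Nat.zero_lt_one.trans_le (hr.trans S.rank_le_card_width)
  have hm' : (0 : ℝ) < Fintype.card V := Nat.cast_pos.mpr hm
  have : Nonempty V := Fintype.card_pos_iff.mp hm
  have : Nonempty (Finset.Icc 1 (Fintype.card V)) := ⟨1, Finset.mem_Icc.mpr ⟨le_rfl, hm⟩⟩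
  have hτ := add_log_two_mul_pos ht (Fintype.card V)
  have hτu := add_log_two_mul_le hm hu
  have hu₀ : 0 < u := hτ.trans_le hτu
  have hn : 0 < n := Nat.cast_pos.mp ((mul_pos hm' hu₀).trans_le hun)
  have hnorm := hsample.measureReal_le_norm_noise_le hτ (by
    rw [← div_eq_mul_inv, le_div_iff₀' hm']
    exact (mul_le_mul_of_nonneg_left hτu hm'.le).trans hun)
  have hleft := hsample.measureReal_lt_frobSq_mul_transpose_noise_mul_le hS hr
    (R := resolventSqrt lam phi εbar) (s := 10 * u) (fun v => by
      simpa [one_apply] using hW.sum_sq_resolventSqrt_mul_le hεbar 1 v) (by positivity)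
  have hright := hsample.measureReal_lt_frobSq_mul_one_sub_mul_noise_mul_le hS hr
    (R := resolventSqrt lam phi εbar) (s := 10 * u) (fun v =>
      (hW.sum_sq_resolventSqrt_mul_le hεbar _ v).trans (sum_sq_one_sub_suppProj_le_one S v))
    (by positivity)
  rw [hW.frobSq_resolventSqrt hεbar, Fintype.card_coe, Nat.card_Icc, Nat.add_sub_cancel]
    at hleft hright
  have hfail := norm_failure_le ht.le (Nat.one_le_cast.mpr hm)
  have hfail' := frobSq_failure_le ht.le (Nat.one_le_cast.mpr hm) hu
  exact one_sub_le_measureReal_of_union hnorm hleft hright (by linarith) fun ω hω₁ hω₂ hω₃ =>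
    l2Sq_sub_le_of_noise_le hW hεbar hS hν hcoh ht hu hn hD hDsymm hSD (hmin ω).1 (hmin ω).2
      (not_le.mp hω₁).le (not_lt.mp hω₂) (not_lt.mp hω₃)

theorem corollary1_general {c : ℝ} (hc : 0 ≤ c) (hW : IsSpectralRepr W lam phi) {k₀ s : ℕ}
    (hk₀ : k₀ ∈ Finset.Icc 1 (Fintype.card V)) (hk₀pos : 0 < lam k₀)
    (htail : ∀ s, k₀ ≤ s → s ≤ Fintype.card V →
      ∑ k ∈ Finset.Icc s (Fintype.card V), 1 / lam k ≤ c * (s / lam s))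
    (hs : s ∈ Finset.Icc k₀ (Fintype.card V + 1))
    (hεbar : invEig (Fintype.card V) lam s ≤ εbar) (hS : S.IsSymm) (hr : 1 ≤ S.rank)
    (hν : 1 ≤ ν)
    (hcoh : ∀ k ∈ Finset.Icc 1 (Fintype.card V),
      ∑ j ∈ Finset.Icc 1 k, projSq (supp S) (phi j) ≤ ν * S.rank * k / Fintype.card V)
    {D : Set (Matrix V V ℝ)} (hD : Convex ℝ D) (hDsymm : ∀ T ∈ D, T.IsSymm) (hSD : S ∈ D)
    (ht : 0 < t) (hu : t + Real.log (8 * Fintype.card V) ≤ u) (hun : Fintype.card V * u ≤ n)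
    {X X' : Fin n → Ω → V} {Y : Fin n → Ω → ℝ} (hsample : IsSample μ S X X' Y)
    {Shat : Ω → Matrix V V ℝ}
    (hmin : ∀ ω, Shat ω ∈ D ∧
      IsMinOn (risk W (regEps t n (Fintype.card V)) εbar (X · ω) (X' · ω) (Y · ω)) D (Shat ω)) :
    1 - Real.exp (-t) ≤ μ.real {ω |
      l2Sq (Shat ω - S)
        ≤ 656 * (1 + c) * (ν * S.rank * s * u / n) + εbar * l2Sq (CFC.sqrt W * S)
          + 25600 * maxCoherence (supp S) * (Fintype.card V * u / n) ^ 2} := by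
  obtain ⟨hk₀s, hsm⟩ := Finset.mem_Icc.mp hs
  have hs₁ : 1 ≤ s := (Finset.mem_Icc.mp hk₀).1.trans hk₀s
  have hlam (h : s ≤ Fintype.card V) : 0 < lam s :=
    hk₀pos.trans_le (hW.mono k₀ hk₀ s (Finset.mem_Icc.mpr ⟨hs₁, h⟩) hk₀s)
  have hεbar₀ : 0 ≤ εbar := by
    refine le_trans ?_ hεbar
    rw [invEig]
    split_ifs with hsV
    · exact inv_nonneg.mpr (hlam hsV).le
    · exact le_rfl
  have hu₀ : 0 ≤ u := by
    have hlog := Real.log_natCast_nonneg (8 * Fintype.card V)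
    push_cast at hlog
    linarith
  have hdim := effectiveDim_le hc hW.nonneg hW.mono (Finset.mem_Icc.mpr ⟨hs₁, hsm⟩) hlam
    (htail s hk₀s) hεbar₀ hεbar
  refine (one_sub_exp_neg_le_measureReal_l2Sq_sub_le hW hεbar₀ hS hr hν hcoh hD hDsymm hSD ht hu
    hun hsample hmin).trans (measureReal_mono (Set.ofPred_subset_ofPred_of_imp fun ω hω => ?_))
  have hmain : 656 * (ν * S.rank * effectiveDim (Fintype.card V) lam εbar * u / n)
      ≤ 656 * (1 + c) * (ν * S.rank * s * u / n) :=
    calc _ ≤ 656 * (ν * S.rank * ((1 + c) * s) * u / n) := by gcongr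
      _ = _ := by ring
  linarith

end HighProbability

end SimilarityKernel

end

open SimilarityKernel in
theorem corollary1 (c : ℝ) (hc : 0 < c) :
    ∃ C C₁ : ℝ, 0 < C ∧ 0 < C₁ ∧
      ∀ (V : Type*) [Fintype V] [DecidableEq V] [MeasurableSpace V] [MeasurableSingletonClass V]
        (Ω : Type*) [MeasurableSpace Ω] (μ : MeasureTheory.Measure Ω)
        [MeasureTheory.IsProbabilityMeasure μ]
        (ζ : ℝ) (_ : 1 ≤ ζ) (t : ℝ) (_ : 0 < t)
        -- the matrix `W` and its spectrum
        (W : Matrix V V ℝ) (lam : ℕ → ℝ) (phi : ℕ → EuclideanSpace ℝ V) (k₀ : ℕ)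
        (_ : IsSpectralRepr W lam phi)
        (_ : SpectrumCondition (Fintype.card V) lam k₀ ζ c)
        -- the target kernel
        (Sstar : Matrix V V ℝ) (_ : Sstar.IsSymm) (_ : 1 ≤ Sstar.rank)
        -- weak low coherence
        (ν : ℝ) (_ : 1 ≤ ν)
        (_ : ∀ k ∈ Finset.Icc 1 (Fintype.card V),
          ∑ j ∈ Finset.Icc 1 k, projSq (supp Sstar) (phi j)
            ≤ ν * Sstar.rank * k / Fintype.card V)
        -- the constraint set
        (D : Set (Matrix V V ℝ)) (_ : IsClosed D) (_ : Convex ℝ D) (_ : ∀ S ∈ D, S.IsSymm)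
        (_ : Sstar ∈ D)
        -- the data
        (n : ℕ) (_ : Fintype.card V * tnm t ζ n (Fintype.card V) ≤ n)
        (X X' : Fin n → Ω → V) (Y : Fin n → Ω → ℝ) (_ : IsSample μ Sstar X X' Y)
        -- the smoothness parameter
        (s : ℕ) (_ : s ∈ Finset.Icc (k₀ + 1) (Fintype.card V + 1))
        (εbar : ℝ) (_ : εbar ∈ Set.Ioc (invEig (Fintype.card V) lam s)
          (invEig (Fintype.card V) lam (s - 1)))
        -- the estimator
        (Shat : Ω → Matrix V V ℝ)
        (_ : ∀ ω, Shat ω ∈ D ∧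
          IsMinOn (risk W (regEps t n (Fintype.card V)) εbar
            (fun j => X j ω) (fun j => X' j ω) (fun j => Y j ω)) D (Shat ω)),
        1 - Real.exp (-t) ≤ μ.real {ω |
          l2Sq (Shat ω - Sstar)
            ≤ C * (ν * Sstar.rank * s * tnm t ζ n (Fintype.card V) / n)
              + εbar * l2Sq (CFC.sqrt W * Sstar)
              + C₁ * maxCoherence (supp Sstar)
                * (Fintype.card V * tnm t ζ n (Fintype.card V) / n) ^ 2} := by
  refine ⟨656 * (1 + c), 25600, by positivity, by norm_num, ?_⟩
  intro V _ _ _ _ Ω _ μ _ ζ hζ t ht W lam phi k₀ hW hspec Sstar hS hr ν hν hcoh D _ hD hDsymm hSD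
    n hn X X' Y hsample s hs εbar hεbar Shat hShat
  exact corollary1_general hc.le hW hspec.isLeast.1.1 hspec.isLeast.1.2 hspec.tail
    (Finset.Icc_subset_Icc_left k₀.le_succ hs) hεbar.1.le hS hr hν hcoh hD hDsymm hSD ht
    (add_log_eight_mul_le_tnm ht (by positivity) hn) hn hsample hShat
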